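/- Let $n\ge 0$, $\Pi=\{0,\dots,n\}$, and let $IS_n$ be the set of directed graphs $G$ on $\Pi$ (loops allowed) such that for all $a,b,c\in\Pi$: $(a,b),(b,c)\in A(G)$ implies $(a,c)\in A(G)$, and $(a,b)\in A(G)$ or $(b,a)\in A(G)$ (in particular every loop $(a,a)$ is an arc). Let $IIS_n=IS_n^{\omega}$ be the set of infinite sequences $w=G_1G_2\cdots$ of graphs in $IS_n$. Let $S^n\subset\mathbb R^N$ be a simplex with affinely independent vertices $x_0^*,\dots,x_n^*$, and let $|S^n|$ be its convex hull. For $G\in IS_n$ and points $x=(x_i)_{i\in\Pi}$ of $\mathbb R^N$ define $\mu_G(x)=(x_i')_{i\in\Pi}$ by $$x_i'=\frac{1-\frac{d}{2d+1}}{d+1}\,x_i+\sum_{j\in V_i,\ j\ne i}\frac{1+\frac{1}{2d+1}}{d+1}\,x_j,\qquad V_i=\{j\mid (j,i)\in A(G)\},\quad d=\# V_i-1 .$$ For $w=G_1G_2\cdots\in IIS_n$, let $geo(w)\in\mathbb R^N$ be the common limit (it always exists), as $r\to\infty$, of all the $n+1$ vertices of $\mu_{G_r}\circ\cdots\circ\mu_{G_1}(x^*)$.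 For $M\subseteq IIS_n$ put $geo(M)=\{geo(w)\mid w\in M\}$. Consider deterministic synchronous algorithms in which each process $p\in\Pi$ starts with an initial value in $\{0,\dots,n\}$; in round $r$ of scenario $w=G_1G_2\cdots$ each process may send a message to all the processes, $q$ receives the message of $p$ exactly when $(p,q)\in A(G_r)$, and each process then updates its state from its previous state and the messages received, whose senders it knows. Depending on its state a process may output a value in $\{0,\dots,n\}$; the first value that it outputs is its irrevocable decision. An algorithm is non-silent if it sends messages forever, so that a process may still participate after having decided. An algorithm solves set-agreement on $M$ if for all initial values and all $w\in M$: at most $n$ different values are decided, every decided value is the initial value of some process, and every process decides. If $M\subseteq IIS_n$ and $geo(M)=|S^n|$, then no algorithm, not even a non-silent one, solves set-agreement on $M$. -/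

import Mathlib

namespace SubIIS

/-- The set of processes `0, …, n`. -/
abbrev Proc (n : ℕ) : Type := Fin (n + 1)

/-! ### Message adversaries -/

/-- A dynamic graph (scenario): an infinite sequence of directed graphs on the processes.
`w r` is the instant graph of the `(r + 1)`-st round. -/
abbrev Scenario (n : ℕ) : Type := ℕ → Digraph (Proc n)

/-- Immediacy property of an instant graph. -/
def Immediacy {n : ℕ} (G : Digraph (Proc n)) : Prop :=
  ∀ a b c, G.Adj a b → G.Adj b c → G.Adj a c

/-- Containment property of an instant graph.  The case `a = b` says that every process has a
loop, i.e. always receives its own message. -/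
def Containment {n : ℕ} (G : Digraph (Proc n)) : Prop :=
  ∀ a b, G.Adj a b ∨ G.Adj b a

/-- The immediate snapshot graphs. -/
def IS (n : ℕ) : Set (Digraph (Proc n)) := {G | Immediacy G ∧ Containment G}

/-- The iterated immediate snapshot message adversary `IS_n ^ ω`. -/
def IIS (n : ℕ) : Set (Scenario n) := {w | ∀ r, w r ∈ IS n}

open Classical in
/-- The set of processes from which `i` receives a message under the instant graph `G`. -/
noncomputable def view {n : ℕ} (G : Digraph (Proc n)) (i : Proc n) : Finset (Proc n) :=
  Finset.univ.filter fun j => G.Adj j i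

/-! ### Geometrization -/

/-- The chromatic average of the point `x i` with respect to the points `x j`, `j ∈ V`,
where `V` is a set of `d + 1` processes containing `i`. -/
noncomputable def zeta {n N : ℕ} (x : Proc n → EuclideanSpace ℝ (Fin N))
    (V : Finset (Proc n)) (i : Proc n) : EuclideanSpace ℝ (Fin N) :=
  let d : ℝ := (V.card : ℝ) - 1
  ((1 - d / (2 * d + 1)) / (d + 1)) • x i
    + ∑ j ∈ V.erase i, ((1 + 1 / (2 * d + 1)) / (d + 1)) • x j

/-- One round of the Chromatic Average algorithm under the instant graph `G`, applied to the
simplex whose vertex of colour `i` is `x i`. -/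
noncomputable def mu {n N : ℕ} (G : Digraph (Proc n))
    (x : Proc n → EuclideanSpace ℝ (Fin N)) : Proc n → EuclideanSpace ℝ (Fin N) :=
  fun i => zeta x (view G i) i

/-- The vertices of the simplex obtained from `x` after the first `r` rounds of `w`. -/
noncomputable def geoPrefix {n N : ℕ} (x : Proc n → EuclideanSpace ℝ (Fin N))
    (w : Scenario n) : ℕ → Proc n → EuclideanSpace ℝ (Fin N)
  | 0 => x
  | r + 1 => mu (w r) (geoPrefix x w r)

/-- `y` is the geometrization of the scenario `w`: the simplices obtained from `S` by running
the Chromatic Average algorithm along `w` converge to the point `y`. -/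
def IsGeo {n N : ℕ} (S : Affine.Simplex ℝ (EuclideanSpace ℝ (Fin N)) n)
    (w : Scenario n) (y : EuclideanSpace ℝ (Fin N)) : Prop :=
  ∀ i, Filter.Tendsto (fun r => geoPrefix S.points w r i) Filter.atTop (nhds y)

/-- The geometrization of a message adversary: the set of the limit points of its scenarios. -/
def geo {n N : ℕ} (S : Affine.Simplex ℝ (EuclideanSpace ℝ (Fin N)) n)
    (M : Set (Scenario n)) : Set (EuclideanSpace ℝ (Fin N)) :=
  {y | ∃ w ∈ M, IsGeo S w y}

/-! ### Distributed algorithms -/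

/-- A deterministic synchronous algorithm for the processes `0, …, n` with inputs and outputs
in `{0, …, n}`.  Nothing restricts what a process does after it has produced an output: it may
go on sending messages forever (non-silent algorithms), or stop sending (`send` is `none`). -/
structure Algorithm.{u, v} (n : ℕ) where
  /-- local states -/
  State : Type u
  /-- messages -/
  Msg : Type v
  /-- the initial state of a process with a given initial value -/
  start : Proc n → Proc n → State
  /-- the message, if any, that a process sends to all processes in a given state -/
  send : Proc n → State → Option Msg
  /-- the new state of a process, from its state and the messages received, by sender -/
  update : Proc n → State → (Proc n → Option Msg) → State
  /-- the value, if any, that a process outputs in a given state -/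
  output : Proc n → State → Option (Proc n)

open Classical in
/-- The states of the processes after `t` rounds of the execution of `A` under the scenario `w`
with initial values `ι`. -/
noncomputable def Algorithm.state {n : ℕ} (A : Algorithm n) (ι : Proc n → Proc n)
    (w : Scenario n) : ℕ → Proc n → A.State
  | 0 => fun p => A.start p (ι p)
  | t + 1 => fun p =>
      A.update p (A.state ι w t p)
        (fun q => if (w t).Adj q p then A.send q (A.state ι w t q) else none)

/-- In the execution of `A` under `w` with initial values `ι`, process `p` decides `v`.
Decisions are irrevocable: the decision is the first value that the process outputs. -/
def Algorithm.Decides {n : ℕ} (A : Algorithm n) (ι : Proc n → Proc n) (w : Scenario n)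
    (p v : Proc n) : Prop :=
  ∃ t, A.output p (A.state ι w t p) = some v ∧
    ∀ s < t, A.output p (A.state ι w s p) = none

/-- `A` solves set-agreement on the message adversary `M`. -/
structure Algorithm.SolvesSetAgreement {n : ℕ} (A : Algorithm n) (M : Set (Scenario n)) :
    Prop where
  agreement : ∀ ι : Proc n → Proc n, ∀ w ∈ M, {v | ∃ p, A.Decides ι w p v}.ncard ≤ n
  validity : ∀ ι : Proc n → Proc n, ∀ w ∈ M, ∀ p v, A.Decides ι w p v → ∃ q, v = ι q
  termination : ∀ ι : Proc n → Proc n, ∀ w ∈ M, ∀ p, ∃ v, A.Decides ι w p v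

end SubIIS

/-!
Suppose that `A` solves set-agreement on `M`.  The idea is to turn `A` into an algorithm that
decides within a fixed number of rounds in all scenarios of `IIS n`, not only in those of `M`, and
to refute the latter by Sperner's lemma.

*Limits.*  One round of the chromatic average is a stochastic matrix (`stepMatrix`), and in each
round all processes hear a common one, so the products of these matrices converge to a matrix with
equal rows (`exists_tendsto_flow`).  The row, `limitWeights w s`, lists the barycentric coordinates
of the limit of `w` in the simplex reached after `s` rounds.  The hypothesis on `M` says that every
scenario has the limit of some scenario of `M` (`exists_mem_limitWeights_eq`).

*Faces.*  The simplices of a chromatic subdivision meet along common faces (`stepMatrix_separates`):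
a point determines its coordinates, and the views of the processes of positive coordinate.  Hence
two scenarios with the same limit cannot be told apart by the processes that have positive weight
(`agreeOn_limitWeights_pos`).  There are two consequences.  First, continuing a finite execution
with complete graphs leads to an interior point, so every finite execution occurs in `M`
(`exists_mem_forall_lt_eq`).  Secondly, every scenario `w` has a process whose weight stays
positive; it behaves as in a scenario of `M` with the same limit, so it decides.  As its weight at
that time is positive, the flow of `w` carries its decision to all processes
(`Algorithm.exists_forall_relay_isSome`).  By compactness of `IIS n`, a time `T` by which every
process knows some decision can be chosen uniformly (`exists_uniform_time`).

*Sperner.*  Let the initial values be distinct and let each process output, at time `T`, a decision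
that it knows of.  This colours the vertices of the `T`-fold chromatic subdivision, and validity
makes it a Sperner colouring.  So some simplex has all `n + 1` colours
(`IsSpernerColoring.exists_surjective`), and the same first `T` rounds occur in a scenario of `M`,
where `n + 1` values are then decided.  The lemma itself is proved by the usual parity argument
along the faces `0, …, k - 1`.  A facet opposite to the vertex of `p` lies on exactly two simplices,
exchanged by `toggle`, unless `p` is never heard by the other processes of the face: given the views
of the other processes, `p` has two possible views in the last round in which it is heard, and its
views in later rounds are determined.
-/

namespace SubIIS

open Finset Filter Topology

variable {n N : ℕ}

/-! ### Immediate snapshot graphs -/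

theorem mem_view {G : Digraph (Proc n)} {i j : Proc n} : j ∈ view G i ↔ G.Adj j i := by
  classical
  simp [view]

theorem adj_refl {G : Digraph (Proc n)} (hG : G ∈ IS n) (i : Proc n) : G.Adj i i :=
  (hG.2 i i).elim id id

theorem adj_trans {G : Digraph (Proc n)} (hG : G ∈ IS n) {a b c : Proc n} (hab : G.Adj a b)
    (hbc : G.Adj b c) : G.Adj a c :=
  hG.1 a b c hab hbc

theorem adj_of_not_adj {G : Digraph (Proc n)} (hG : G ∈ IS n) {a b : Proc n} (h : ¬ G.Adj a b) :
    G.Adj b a :=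
  (hG.2 a b).resolve_left h

theorem card_view_pos {G : Digraph (Proc n)} (hG : G ∈ IS n) (i : Proc n) :
    1 ≤ (view G i).card :=
  Finset.card_pos.2 ⟨i, mem_view.2 (adj_refl hG i)⟩

/-- In an immediate snapshot graph, every nonempty set of processes has a member that is heard by
all the members of the set. -/
theorem exists_source {G : Digraph (Proc n)} (hG : G ∈ IS n) (s : Finset (Proc n))
    (hs : s.Nonempty) : ∃ k ∈ s, ∀ i ∈ s, G.Adj k i := by
  obtain ⟨k, hk, hmin⟩ := s.exists_min_image (fun k => (view G k).card) hs
  refine ⟨k, hk, fun i hi => ?_⟩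
  by_contra h
  have hik := adj_of_not_adj hG h
  refine (hmin i hi).not_gt (Finset.card_lt_card ⟨fun j hj => ?_, fun hsub => ?_⟩)
  · exact mem_view.2 (adj_trans hG (mem_view.1 hj) hik)
  · exact h (mem_view.1 (hsub (mem_view.2 (adj_refl hG k))))

theorem top_mem_IS : (⊤ : Digraph (Proc n)) ∈ IS n :=
  ⟨fun _ _ _ _ _ => trivial, fun _ _ => Or.inl trivial⟩

/-! ### The averaging matrix of a round -/

open Classical in
/-- The matrix of the chromatic average under `G`: the new vertex of colour `i` is
`∑ j, stepMatrix G i j • x j`.  With `k = #(view G i)`, the coefficients of `zeta` simplify to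
`1 / (2 * k - 1)` for `i` itself and `2 / (2 * k - 1)` for the other members of the view. -/
noncomputable def stepMatrix (G : Digraph (Proc n)) : Matrix (Proc n) (Proc n) ℝ :=
  fun i j => ((if G.Adj j i then 2 else 0) - if i = j then 1 else 0) /
    (2 * ((view G i).card : ℝ) - 1)

theorem den_pos {G : Digraph (Proc n)} (hG : G ∈ IS n) (i : Proc n) :
    0 < 2 * ((view G i).card : ℝ) - 1 := by
  have : (1 : ℝ) ≤ (view G i).card := by exact_mod_cast card_view_pos hG i
  linarith

theorem stepMatrix_pos {G : Digraph (Proc n)} (hG : G ∈ IS n) {i j : Proc n} (h : G.Adj j i) :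
    0 < stepMatrix G i j := by
  unfold stepMatrix
  refine div_pos ?_ (den_pos hG i)
  rw [if_pos h]
  split_ifs <;> norm_num

theorem stepMatrix_eq_zero {G : Digraph (Proc n)} (hG : G ∈ IS n) {i j : Proc n}
    (h : ¬ G.Adj j i) : stepMatrix G i j = 0 := by
  have : i ≠ j := by
    rintro rfl
    exact h (adj_refl hG _)
  simp [stepMatrix, h, this]

theorem stepMatrix_nonneg {G : Digraph (Proc n)} (hG : G ∈ IS n) (i j : Proc n) :
    0 ≤ stepMatrix G i j := by
  by_cases h : G.Adj j i
  · exact (stepMatrix_pos hG h).le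
  · exact (stepMatrix_eq_zero hG h).ge

theorem sum_stepMatrix {G : Digraph (Proc n)} (hG : G ∈ IS n) (i : Proc n) :
    ∑ j, stepMatrix G i j = 1 := by
  classical
  unfold stepMatrix
  rw [← Finset.sum_div, div_eq_one_iff_eq (den_pos hG i).ne', Finset.sum_sub_distrib,
    ← Finset.sum_filter]
  have : (Finset.univ.filter fun j => G.Adj j i) = view G i := by
    ext j
    simp [mem_view]
  simp [this, mul_comm]

theorem le_stepMatrix {G : Digraph (Proc n)} (hG : G ∈ IS n) {i j : Proc n} (h : G.Adj j i) :
    1 / (2 * (n : ℝ) + 1) ≤ stepMatrix G i j := by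
  unfold stepMatrix
  have hcard : ((view G i).card : ℝ) ≤ n + 1 := by
    have := Finset.card_le_univ (view G i)
    rw [Fintype.card_fin] at this
    exact_mod_cast this
  rw [if_pos h]
  refine div_le_div₀ ?_ ?_ (den_pos hG i) (by linarith)
  · split_ifs <;> norm_num
  · split_ifs <;> norm_num

theorem mu_eq_sum {G : Digraph (Proc n)} (hG : G ∈ IS n) (x : Proc n → EuclideanSpace ℝ (Fin N))
    (i : Proc n) : mu G x i = ∑ j, stepMatrix G i j • x j := by
  classical
  have hi : i ∈ view G i := mem_view.2 (adj_refl hG i)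
  have hk := den_pos hG i
  have hk' : (1 : ℝ) ≤ (view G i).card := by exact_mod_cast card_view_pos hG i
  rw [← Finset.sum_subset (Finset.subset_univ (view G i)) fun j _ hj => by
    rw [stepMatrix_eq_zero hG (mt mem_view.2 hj), zero_smul], ← Finset.add_sum_erase _ _ hi]
  have hden : 2 * ((view G i).card - 1 : ℝ) + 1 = 2 * ((view G i).card : ℝ) - 1 := by ring
  have hcard : ((view G i).card : ℝ) ≠ 0 := by linarith
  have hk0 := hk.ne'
  simp only [mu, zeta, hden, sub_add_cancel]
  refine congrArg₂ (· + ·) ?_ (Finset.sum_congr rfl fun j hj => ?_)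
  · congr 1
    simp only [stepMatrix, if_pos (adj_refl hG i), if_true]
    rw [div_eq_div_iff hcard hk0, one_sub_div hk0, div_mul_cancel₀ _ hk0]
    ring
  · congr 1
    rw [Finset.mem_erase] at hj
    simp only [stepMatrix, if_pos (mem_view.1 hj.2), if_neg (Ne.symm hj.1)]
    rw [div_eq_div_iff hcard hk0, one_add_div hk0, div_mul_cancel₀ _ hk0]
    ring

/-! ### One round separates the faces of the chromatic subdivision -/

/-- The comparison step for `sublevel_unique`: two solutions of the system
`s j = ∑_{s i ≤ s j} (2 * s i - y i)` cannot differ at a least level at which they differ, because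
from that level on the sums grow by at least twice the growth of the level. -/
theorem sublevel_comparison {ι : Type*} [Fintype ι] {s s' y : ι → ℝ}
    (hs : ∀ j, s j = ∑ i with s i ≤ s j, (2 * s i - y i))
    (hs' : ∀ j, s' j = ∑ i with s' i ≤ s' j, (2 * s' i - y i))
    (hb' : ∀ i, 0 ≤ 2 * s' i - y i) {j : ι} (hj : s j < s' j)
    (hmin : ∀ i, s i ≠ s' i → s j ≤ s i ∧ s j ≤ s' i) : False := by
  classical
  obtain ⟨k, hk, hmax⟩ := (Finset.univ.filter fun i => s i = s j).exists_max_image s' ⟨j, by simp⟩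
  simp only [Finset.mem_filter, Finset.mem_univ, true_and] at hk hmax
  have hlow : ∀ i, s i < s j → s' i = s i := fun i hi => by
    by_contra h
    exact absurd (hmin i (Ne.symm h)).1 hi.not_ge
  have hK : ∀ i, s i = s j → s j ≤ s' i := fun i hi => by
    by_cases h : s i = s' i
    · rw [← h, hi]
    · exact (hmin i h).2
  have hjk : s j < s' k := hj.trans_le (hmax j rfl)
  -- Going from `s` to `s'`, the members of the level of `j` gain at least `2 * (s' k - s j)`.
  have h1 : s j + 2 * (s' k - s j) ≤ s' k := by
    calc s j + 2 * (s' k - s j)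
        ≤ ∑ i with s i ≤ s j, (2 * s i - y i) + ∑ i with s i ≤ s j, 2 * (s' i - s i) := by
          rw [← hs j]
          refine add_le_add_right ?_ _
          rw [← hk]
          refine Finset.single_le_sum (f := fun i => 2 * (s' i - s i)) (fun i hi => ?_) ?_
          · rw [Finset.mem_filter] at hi
            rcases (hk ▸ hi.2 : s i ≤ s j).lt_or_eq with h | h
            · rw [hlow i h, sub_self, mul_zero]
            · have := hK i h
              linarith
          · simp
      _ = ∑ i with s i ≤ s j, (2 * s' i - y i) := by
          rw [← Finset.sum_add_distrib]
          exact Finset.sum_congr rfl fun i _ => by ring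
      _ ≤ ∑ i with s' i ≤ s' k, (2 * s' i - y i) := by
          refine Finset.sum_le_sum_of_subset_of_nonneg (fun i hi => ?_) fun i _ _ => hb' i
          simp only [Finset.mem_filter, Finset.mem_univ, true_and] at hi ⊢
          rcases hi.lt_or_eq with h | h
          · rw [hlow i h]
            exact (h.trans hjk).le
          · exact hmax i h
      _ = s' k := (hs' k).symm
  linarith

/-- The system `s j = ∑_{s i ≤ s j} (2 * s i - y i)` with nonnegative summands has at most one
solution. -/
theorem sublevel_unique {ι : Type*} [Fintype ι] {s s' y : ι → ℝ}
    (hs : ∀ j, s j = ∑ i with s i ≤ s j, (2 * s i - y i))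
    (hs' : ∀ j, s' j = ∑ i with s' i ≤ s' j, (2 * s' i - y i))
    (hb : ∀ i, 0 ≤ 2 * s i - y i) (hb' : ∀ i, 0 ≤ 2 * s' i - y i) : s = s' := by
  classical
  by_contra hne
  obtain ⟨j₀, hj₀⟩ := Function.ne_iff.1 hne
  obtain ⟨j, hj, hmin⟩ := (Finset.univ.filter fun i => s i ≠ s' i).exists_min_image
    (fun i => min (s i) (s' i)) ⟨j₀, by simpa using hj₀⟩
  simp only [Finset.mem_filter, Finset.mem_univ, true_and] at hj hmin
  rcases lt_or_gt_of_ne hj with h | h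
  · refine sublevel_comparison hs hs' hb' h fun i hi => ?_
    have := hmin i hi
    rw [min_eq_left h.le] at this
    exact le_min_iff.1 this
  · refine sublevel_comparison hs' hs hb h fun i hi => ?_
    have := hmin i (Ne.symm hi)
    rw [min_eq_right h.le] at this
    exact (le_min_iff.1 this).symm

/-- Let `b i` be the weight `c i` divided by the denominator of row `i`, and let `s j` be the sum
of the `b i` over the processes `i` that hear `j`.  A process `i` of positive weight hears exactly
the `j` with `s i ≤ s j`, and the barycentric coordinates are `2 * s j - b j`; so `s` solves the
system of `sublevel_unique`, whose data are the barycentric coordinates alone. -/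
theorem exists_levels {G : Digraph (Proc n)} (hG : G ∈ IS n) {c : Proc n → ℝ}
    (hc : ∀ i, 0 ≤ c i) : ∃ s : Proc n → ℝ,
      (∀ i, 2 * s i - (Matrix.vecMul c (stepMatrix G)) i = c i / (2 * ((view G i).card : ℝ) - 1)) ∧
      (∀ i, 0 < c i → ∀ j, G.Adj j i ↔ s i ≤ s j) ∧
      ∀ j, s j = ∑ i with s i ≤ s j, (2 * s i - (Matrix.vecMul c (stepMatrix G)) i) := by
  classical
  set b : Proc n → ℝ := fun i => c i / (2 * ((view G i).card : ℝ) - 1) with hb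
  have hb0 : ∀ i, 0 ≤ b i := fun i => div_nonneg (hc i) (den_pos hG i).le
  set s : Proc n → ℝ := fun j => ∑ i with G.Adj j i, b i with hs
  have hy : ∀ j, 2 * s j - (Matrix.vecMul c (stepMatrix G)) j = b j := by
    intro j
    have : Matrix.vecMul c (stepMatrix G) j
        = ∑ i, (2 * (if G.Adj j i then b i else 0) - if i = j then b i else 0) := by
      rw [Matrix.vecMul, dotProduct]
      refine Finset.sum_congr rfl fun i _ => ?_
      simp only [stepMatrix, hb]
      split_ifs <;> ring
    rw [this, Finset.sum_sub_distrib, ← Finset.mul_sum, ← Finset.sum_filter]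
    simp [hs]
  have hview : ∀ i, 0 < c i → ∀ j, G.Adj j i ↔ s i ≤ s j := by
    intro i hi j
    constructor
    · intro h
      refine Finset.sum_le_sum_of_subset_of_nonneg (fun k hk => ?_) fun k _ _ => hb0 k
      simp only [Finset.mem_filter, Finset.mem_univ, true_and] at hk ⊢
      exact adj_trans hG h hk
    · intro hle
      by_contra h
      refine hle.not_gt (Finset.sum_lt_sum_of_subset (i := i) (fun k hk => ?_) ?_ ?_ ?_ ?_)
      · simp only [Finset.mem_filter, Finset.mem_univ, true_and] at hk ⊢
        exact adj_trans hG (adj_of_not_adj hG h) hk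
      · simpa using adj_refl hG i
      · simpa using h
      · exact div_pos hi (den_pos hG i)
      · exact fun k _ _ => hb0 k
  refine ⟨s, hy, hview, fun j => ?_⟩
  simp only [hy]
  change ∑ i with G.Adj j i, b i = _
  rw [Finset.sum_filter, Finset.sum_filter]
  refine Finset.sum_congr rfl fun i _ => ?_
  rcases (hc i).eq_or_lt with h | h
  · simp [hb, ← h]
  · simp only [hview i h]

/-- A point of the chromatic subdivision of the standard simplex determines its barycentric
coordinates and, for every process of positive weight, the view of that process: the simplices of
the subdivision meet along common faces. -/
theorem stepMatrix_separates {G G' : Digraph (Proc n)} (hG : G ∈ IS n) (hG' : G' ∈ IS n)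
    {c c' : Proc n → ℝ} (hc : ∀ i, 0 ≤ c i) (hc' : ∀ i, 0 ≤ c' i)
    (h : Matrix.vecMul c (stepMatrix G) = Matrix.vecMul c' (stepMatrix G')) :
    c = c' ∧ ∀ i, 0 < c i → ∀ j, G.Adj j i ↔ G'.Adj j i := by
  obtain ⟨s, hb, hv, hs⟩ := exists_levels hG hc
  obtain ⟨s', hb', hv', hs'⟩ := exists_levels hG' hc'
  rw [← h] at hb' hs'
  obtain rfl : s = s' := sublevel_unique hs hs'
    (fun i => (hb i).ge.trans' (div_nonneg (hc i) (den_pos hG i).le))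
    (fun i => (hb' i).ge.trans' (div_nonneg (hc' i) (den_pos hG' i).le))
  have hbb : ∀ i, c i / (2 * ((view G i).card : ℝ) - 1) = c' i / (2 * ((view G' i).card : ℝ) - 1) :=
    fun i => (hb i).symm.trans (hb' i)
  have hpos : ∀ i, 0 < c i → 0 < c' i := fun i hi => by
    have := div_pos hi (den_pos hG i)
    rw [hbb] at this
    exact (div_pos_iff_of_pos_right (den_pos hG' i)).1 this
  have hadj : ∀ i, 0 < c i → ∀ j, G.Adj j i ↔ G'.Adj j i := fun i hi j =>
    (hv i hi j).trans (hv' i (hpos i hi) j).symm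
  refine ⟨funext fun i => ?_, hadj⟩
  have hi := hbb i
  rcases (hc i).eq_or_lt with h0 | h0
  · rw [← h0, zero_div, eq_comm, div_eq_zero_iff] at hi
    rw [← h0, hi.resolve_right (den_pos hG' i).ne']
  · have hvv : view G i = view G' i := by
      ext j
      rw [mem_view, mem_view, hadj i h0 j]
    rw [hvv] at hi
    exact (div_left_inj' (den_pos hG' i).ne').1 hi

/-! ### Limit weights -/

/-- The product of the averaging matrices of the rounds `s, …, s + r - 1` of `w`, the latest
round on the left: row `i` holds the coordinates of vertex `i` after these rounds with respect to
the vertices before them. -/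
noncomputable def flow (w : Scenario n) (s : ℕ) : ℕ → Matrix (Proc n) (Proc n) ℝ
  | 0 => 1
  | r + 1 => stepMatrix (w (s + r)) * flow w s r

theorem flow_succ_right (w : Scenario n) (s r : ℕ) :
    flow w s (r + 1) = flow w (s + 1) r * stepMatrix (w s) := by
  induction r with
  | zero => simp [flow]
  | succ r ih =>
    rw [flow, ih, ← Matrix.mul_assoc, flow, show s + 1 + r = s + (r + 1) by omega]

theorem flow_nonneg {w : Scenario n} (hw : w ∈ IIS n) (s r : ℕ) (i j : Proc n) :
    0 ≤ flow w s r i j := by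
  classical
  induction r generalizing i with
  | zero =>
    rw [flow, Matrix.one_apply]
    split_ifs <;> norm_num
  | succ r ih =>
    rw [flow, Matrix.mul_apply]
    exact Finset.sum_nonneg fun k _ => mul_nonneg (stepMatrix_nonneg (hw _) i k) (ih k)

theorem sum_flow {w : Scenario n} (hw : w ∈ IIS n) (s r : ℕ) (i : Proc n) :
    ∑ j, flow w s r i j = 1 := by
  classical
  induction r generalizing i with
  | zero => simp [flow, Matrix.one_apply]
  | succ r ih =>
    simp only [flow, Matrix.mul_apply]
    rw [Finset.sum_comm]
    simp only [← Finset.mul_sum, ih, mul_one]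
    exact sum_stepMatrix (hw _) i

/-- Averaging with weights that all give at least `ε` to one common source shrinks the
oscillation by a factor `1 - ε ^ 2`. -/
theorem abs_stepMatrix_sub_le {G : Digraph (Proc n)} (hG : G ∈ IS n) {a : Proc n → ℝ} {D : ℝ}
    (ha : ∀ i i', |a i - a i'| ≤ D) (i i' : Proc n) :
    |∑ k, stepMatrix G i k * a k - ∑ k, stepMatrix G i' k * a k|
      ≤ (1 - (1 / (2 * (n : ℝ) + 1)) ^ 2) * D := by
  obtain ⟨k₀, -, hk₀⟩ := exists_source hG Finset.univ Finset.univ_nonempty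
  set P := stepMatrix G
  have hD : 0 ≤ D := (abs_nonneg _).trans (ha i i)
  have hnn : ∀ k l, 0 ≤ P i k * P i' l := fun k l =>
    mul_nonneg (stepMatrix_nonneg hG _ _) (stepMatrix_nonneg hG _ _)
  have hsum : ∑ k, ∑ l, P i k * P i' l = 1 := by
    simp only [← Finset.mul_sum, P, sum_stepMatrix hG, mul_one]
  have hdiff : ∑ k, P i k * a k - ∑ k, P i' k * a k
      = ∑ k, ∑ l, P i k * P i' l * (a k - a l) := by
    have h1 : ∑ k, ∑ l, P i k * P i' l * a k = ∑ k, P i k * a k := by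
      refine Finset.sum_congr rfl fun k _ => ?_
      rw [← Finset.sum_mul, ← Finset.mul_sum, sum_stepMatrix hG, mul_one]
    have h2 : ∑ k, ∑ l, P i k * P i' l * a l = ∑ l, P i' l * a l := by
      rw [Finset.sum_comm]
      refine Finset.sum_congr rfl fun l _ => ?_
      rw [← Finset.sum_mul, ← Finset.sum_mul, sum_stepMatrix hG, one_mul]
    simp only [mul_sub, Finset.sum_sub_distrib, h1, h2]
  have hε : (1 / (2 * (n : ℝ) + 1)) ^ 2 ≤ P i k₀ * P i' k₀ := by
    rw [sq]
    exact mul_le_mul (le_stepMatrix hG (hk₀ i (Finset.mem_univ _)))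
      (le_stepMatrix hG (hk₀ i' (Finset.mem_univ _))) (by positivity) (stepMatrix_nonneg hG _ _)
  -- The pair `(k₀, k₀)` contributes nothing to the difference.
  have hbound : ∑ k, ∑ l, P i k * P i' l * |a k - a l|
      ≤ ∑ k, ∑ l, (P i k * P i' l * D - if k = k₀ ∧ l = k₀ then P i k₀ * P i' k₀ * D else 0) := by
    refine Finset.sum_le_sum fun k _ => Finset.sum_le_sum fun l _ => ?_
    split_ifs with h
    · rw [h.1, h.2]
      simp
    · rw [sub_zero]
      exact mul_le_mul_of_nonneg_left (ha k l) (hnn k l)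
  have hval : ∑ k, ∑ l, (P i k * P i' l * D - if k = k₀ ∧ l = k₀ then P i k₀ * P i' k₀ * D else 0)
      = D - P i k₀ * P i' k₀ * D := by
    simp only [Finset.sum_sub_distrib, ← Finset.sum_mul, hsum, one_mul, ite_and]
    simp
  calc |∑ k, P i k * a k - ∑ k, P i' k * a k|
      ≤ ∑ k, ∑ l, P i k * P i' l * |a k - a l| := by
        rw [hdiff]
        refine (Finset.abs_sum_le_sum_abs _ _).trans (Finset.sum_le_sum fun k _ =>
          (Finset.abs_sum_le_sum_abs _ _).trans (Finset.sum_le_sum fun l _ => ?_))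
        rw [abs_mul, abs_of_nonneg (hnn k l)]
    _ ≤ D - P i k₀ * P i' k₀ * D := hbound.trans hval.le
    _ ≤ (1 - (1 / (2 * (n : ℝ) + 1)) ^ 2) * D := by
        rw [sub_mul, one_mul]
        exact sub_le_sub_left (mul_le_mul_of_nonneg_right hε hD) _

theorem contraction_factor_mem (n : ℕ) :
    0 ≤ 1 - (1 / (2 * (n : ℝ) + 1)) ^ 2 ∧ 1 - (1 / (2 * (n : ℝ) + 1)) ^ 2 < 1 := by
  have h1 : (1 / (2 * (n : ℝ) + 1)) ≤ 1 := by
    rw [div_le_one (by positivity)]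
    linarith [Nat.cast_nonneg (α := ℝ) n]
  have h0 : 0 < 1 / (2 * (n : ℝ) + 1) := by positivity
  exact ⟨sub_nonneg.2 (pow_le_one₀ h0.le h1), sub_lt_self _ (pow_pos h0 2)⟩

theorem abs_flow_sub_le {w : Scenario n} (hw : w ∈ IIS n) (s r : ℕ) (j i i' : Proc n) :
    |flow w s r i j - flow w s r i' j| ≤ (1 - (1 / (2 * (n : ℝ) + 1)) ^ 2) ^ r := by
  classical
  induction r generalizing i i' with
  | zero =>
    simp only [flow, Matrix.one_apply, pow_zero]
    split_ifs <;> norm_num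
  | succ r ih =>
    rw [flow, Matrix.mul_apply, Matrix.mul_apply, pow_succ']
    exact abs_stepMatrix_sub_le (hw _) ih i i'

theorem exists_tendsto_flow {w : Scenario n} (hw : w ∈ IIS n) (s : ℕ) (j : Proc n) :
    ∃ c : ℝ, ∀ i, Tendsto (fun r => flow w s r i j) atTop (𝓝 c) := by
  set q := 1 - (1 / (2 * (n : ℝ) + 1)) ^ 2 with hq
  obtain ⟨hq0, hq1⟩ := contraction_factor_mem n
  have hcauchy : CauchySeq fun r => flow w s r 0 j := by
    refine cauchySeq_of_le_geometric q 1 hq1 fun r => ?_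
    rw [Real.dist_eq, one_mul, flow, Matrix.mul_apply,
      ← one_mul (flow w s r 0 j), ← sum_stepMatrix (hw (s + r)) 0, Finset.sum_mul,
      ← Finset.sum_sub_distrib]
    calc |∑ k, (stepMatrix (w (s + r)) 0 k * flow w s r 0 j
            - stepMatrix (w (s + r)) 0 k * flow w s r k j)|
        ≤ ∑ k, stepMatrix (w (s + r)) 0 k * q ^ r := by
          refine (Finset.abs_sum_le_sum_abs _ _).trans (Finset.sum_le_sum fun k _ => ?_)
          rw [← mul_sub, abs_mul, abs_of_nonneg (stepMatrix_nonneg (hw _) _ _)]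
          exact mul_le_mul_of_nonneg_left (abs_flow_sub_le hw s r j 0 k)
            (stepMatrix_nonneg (hw _) _ _)
      _ = q ^ r := by rw [← Finset.sum_mul, sum_stepMatrix (hw _), one_mul]
  obtain ⟨c, hc⟩ := cauchySeq_tendsto_of_complete hcauchy
  refine ⟨c, fun i => ?_⟩
  have hdiff : Tendsto (fun r => flow w s r i j - flow w s r 0 j) atTop (𝓝 0) :=
    squeeze_zero_norm (fun r => abs_flow_sub_le hw s r j i 0)
      (tendsto_pow_atTop_nhds_zero_of_lt_one hq0 hq1)
  simpa using hdiff.add hc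

/-- The common limit of the rows of `flow w s r` as `r → ∞`: the barycentric coordinates of the
geometrization of `w`, with respect to the simplex reached after `s` rounds. -/
noncomputable def limitWeights (w : Scenario n) (s : ℕ) (j : Proc n) : ℝ :=
  limUnder atTop fun r => flow w s r 0 j

theorem tendsto_flow {w : Scenario n} (hw : w ∈ IIS n) (s : ℕ) (i j : Proc n) :
    Tendsto (fun r => flow w s r i j) atTop (𝓝 (limitWeights w s j)) := by
  obtain ⟨c, hc⟩ := exists_tendsto_flow hw s j
  rw [limitWeights, (hc 0).limUnder_eq]
  exact hc i

theorem limitWeights_nonneg {w : Scenario n} (hw : w ∈ IIS n) (s : ℕ) (j : Proc n) :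
    0 ≤ limitWeights w s j :=
  ge_of_tendsto' (tendsto_flow hw s 0 j) fun r => flow_nonneg hw s r 0 j

theorem sum_limitWeights {w : Scenario n} (hw : w ∈ IIS n) (s : ℕ) :
    ∑ j, limitWeights w s j = 1 := by
  have h := tendsto_finsetSum Finset.univ fun j _ => tendsto_flow hw s 0 j
  simp only [sum_flow hw] at h
  exact tendsto_nhds_unique h tendsto_const_nhds

theorem limitWeights_eq_vecMul {w : Scenario n} (hw : w ∈ IIS n) (s : ℕ) :
    limitWeights w s = Matrix.vecMul (limitWeights w (s + 1)) (stepMatrix (w s)) := by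
  funext j
  have h := (tendsto_flow hw s 0 j).comp (tendsto_add_atTop_nat 1)
  refine tendsto_nhds_unique h ?_
  simp only [Function.comp_def, flow_succ_right, Matrix.mul_apply, Matrix.vecMul, dotProduct]
  exact tendsto_finsetSum _ fun k _ => (tendsto_flow hw (s + 1) 0 k).mul_const _

/-- A process heard in round `s` by a process that keeps a positive weight has positive weight. -/
theorem limitWeights_pos_of_adj {w : Scenario n} (hw : w ∈ IIS n) {s : ℕ} {i j : Proc n}
    (hi : 0 < limitWeights w (s + 1) i) (hji : (w s).Adj j i) : 0 < limitWeights w s j := by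
  rw [limitWeights_eq_vecMul hw s, Matrix.vecMul, dotProduct]
  exact Finset.sum_pos' (fun k _ => mul_nonneg (limitWeights_nonneg hw _ k)
    (stepMatrix_nonneg (hw s) k j)) ⟨i, Finset.mem_univ i, mul_pos hi (stepMatrix_pos (hw s) hji)⟩

theorem exists_limitWeights_pos {w : Scenario n} (hw : w ∈ IIS n) (s : ℕ) :
    ∃ p, 0 < limitWeights w s p := by
  by_contra! h
  have h0 : ∀ p, limitWeights w s p = 0 := fun p => (h p).antisymm (limitWeights_nonneg hw s p)
  have := sum_limitWeights hw s
  simp [h0] at this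

theorem limitWeights_pos_of_le {w : Scenario n} (hw : w ∈ IIS n) {s t : ℕ} (hst : s ≤ t)
    {p : Proc n} (hp : 0 < limitWeights w t p) : 0 < limitWeights w s p := by
  induction t, hst using Nat.le_induction with
  | base => exact hp
  | succ t _ ih => exact ih (limitWeights_pos_of_adj hw hp (adj_refl (hw t) p))

/-- Some process keeps a positive weight forever. -/
theorem exists_forall_limitWeights_pos {w : Scenario n} (hw : w ∈ IIS n) :
    ∃ p, ∀ s, 0 < limitWeights w s p := by
  by_contra! h
  choose s hs using h
  obtain ⟨p, hp⟩ := exists_limitWeights_pos hw (Finset.univ.sup s)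
  exact (hs p).not_gt (limitWeights_pos_of_le hw (Finset.le_sup (Finset.mem_univ p)) hp)

theorem limitWeights_pos_of_eq_top {w : Scenario n} (hw : w ∈ IIS n) {s : ℕ} (h : w s = ⊤)
    (p : Proc n) : 0 < limitWeights w s p := by
  obtain ⟨q, hq⟩ := exists_limitWeights_pos hw (s + 1)
  exact limitWeights_pos_of_adj hw hq (by rw [h]; trivial)

/-- Two scenarios with the same limit have the same limit weights after every round. -/
theorem limitWeights_eq_of_eq {w w' : Scenario n} (hw : w ∈ IIS n) (hw' : w' ∈ IIS n)
    (h : limitWeights w 0 = limitWeights w' 0) (s : ℕ) :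
    limitWeights w s = limitWeights w' s := by
  induction s with
  | zero => exact h
  | succ s ih =>
    rw [limitWeights_eq_vecMul hw, limitWeights_eq_vecMul hw'] at ih
    exact (stepMatrix_separates (hw s) (hw' s) (limitWeights_nonneg hw _)
      (limitWeights_nonneg hw' _) ih).1

theorem adj_iff_of_limitWeights_eq {w w' : Scenario n} (hw : w ∈ IIS n) (hw' : w' ∈ IIS n)
    (h : limitWeights w 0 = limitWeights w' 0) {s : ℕ} {i : Proc n}
    (hi : 0 < limitWeights w (s + 1) i) (j : Proc n) : (w s).Adj j i ↔ (w' s).Adj j i := by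
  have hs := limitWeights_eq_of_eq hw hw' h s
  rw [limitWeights_eq_vecMul hw, limitWeights_eq_vecMul hw'] at hs
  exact (stepMatrix_separates (hw s) (hw' s) (limitWeights_nonneg hw _)
    (limitWeights_nonneg hw' _) hs).2 i hi j

/-! ### Limit weights and geometrization -/

theorem geoPrefix_eq_sum {w : Scenario n} (hw : w ∈ IIS n)
    (x : Proc n → EuclideanSpace ℝ (Fin N)) (r : ℕ) (i : Proc n) :
    geoPrefix x w r i = ∑ j, flow w 0 r i j • x j := by
  classical
  induction r generalizing i with
  | zero => simp [geoPrefix, flow, Matrix.one_apply]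
  | succ r ih =>
    rw [geoPrefix, mu_eq_sum (hw r)]
    simp only [ih, flow, Matrix.mul_apply, Finset.smul_sum, Finset.sum_smul, smul_smul, zero_add]
    exact Finset.sum_comm

theorem isGeo_iff {S : Affine.Simplex ℝ (EuclideanSpace ℝ (Fin N)) n} {w : Scenario n}
    (hw : w ∈ IIS n) {y : EuclideanSpace ℝ (Fin N)} :
    IsGeo S w y ↔ y = ∑ j, limitWeights w 0 j • S.points j := by
  have h : ∀ i, Tendsto (fun r => geoPrefix S.points w r i) atTop
      (𝓝 (∑ j, limitWeights w 0 j • S.points j)) := fun i => by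
    simp only [geoPrefix_eq_sum hw]
    exact tendsto_finsetSum _ fun j _ => (tendsto_flow hw 0 i j).smul_const _
  refine ⟨fun hy => tendsto_nhds_unique (hy 0) (h 0), ?_⟩
  rintro rfl
  exact h

/-- If the geometrization of `M` fills the simplex, then every scenario has the limit weights of
some scenario of `M`. -/
theorem exists_mem_limitWeights_eq {S : Affine.Simplex ℝ (EuclideanSpace ℝ (Fin N)) n}
    {M : Set (Scenario n)} (hM : M ⊆ IIS n) (hgeo : convexHull ℝ (Set.range S.points) ⊆ geo S M)
    {w : Scenario n} (hw : w ∈ IIS n) :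
    ∃ w' ∈ M, limitWeights w 0 = limitWeights w' 0 := by
  have hmem : ∑ j, limitWeights w 0 j • S.points j ∈ convexHull ℝ (Set.range S.points) :=
    (convex_convexHull ℝ _).sum_mem (fun j _ => limitWeights_nonneg hw 0 j)
      (sum_limitWeights hw 0) fun j _ => subset_convexHull ℝ _ ⟨j, rfl⟩
  obtain ⟨w', hw'M, hw'⟩ := hgeo hmem
  have heq := (isGeo_iff (hM hw'M)).1 hw'
  refine ⟨w', hw'M, ?_⟩
  have h1 := sum_limitWeights hw 0
  have h2 := sum_limitWeights (hM hw'M) 0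
  rw [← Finset.affineCombination_eq_linear_combination _ _ _ h1,
    ← Finset.affineCombination_eq_linear_combination _ _ _ h2] at heq
  exact funext fun j =>
    (S.independent.affineCombination_eq_iff_eq h1 h2).1 heq j (Finset.mem_univ j)

/-! ### Locality of algorithms -/

/-- The sets `Q s` are closed under the views of `w`, and `w` and `w'` have the same views there:
a process of `Q (s + 1)` belongs to `Q s`, hears the same processes in both scenarios in
the round from time `s` to time `s + 1`, and all these processes belong to `Q s`.  No algorithm
can tell `w` and `w'` apart at a process of `Q s` at time `s`. -/
def AgreeOn (w w' : Scenario n) (Q : ℕ → Set (Proc n)) : Prop :=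
  ∀ s, ∀ p ∈ Q (s + 1), p ∈ Q s ∧
    ∀ j, ((w s).Adj j p ↔ (w' s).Adj j p) ∧ ((w s).Adj j p → j ∈ Q s)

theorem Algorithm.state_eq_of_agreeOn (A : Algorithm n) {w w' : Scenario n}
    {Q : ℕ → Set (Proc n)} (h : AgreeOn w w' Q) {ι ι' : Proc n → Proc n}
    (hι : ∀ p ∈ Q 0, ι p = ι' p) (s : ℕ) {p : Proc n} (hp : p ∈ Q s) :
    A.state ι w s p = A.state ι' w' s p := by
  classical
  induction s generalizing p with
  | zero => simp only [Algorithm.state, hι p hp]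
  | succ s ih =>
    obtain ⟨hps, hj⟩ := h s p hp
    simp only [Algorithm.state, ih hps]
    congr 1
    funext q
    by_cases hq : (w s).Adj q p
    · rw [if_pos hq, if_pos ((hj q).1.1 hq), ih ((hj q).2 hq)]
    · rw [if_neg hq, if_neg (mt (hj q).1.2 hq)]

theorem agreeOn_prefix {w w' : Scenario n} {T : ℕ} (h : ∀ s < T, w s = w' s) :
    AgreeOn w w' fun s => {_p | s ≤ T} := by
  intro s _ hp
  have hs : s < T := Nat.lt_of_succ_le hp
  exact ⟨hs.le, fun j => ⟨by rw [h s hs], fun _ => hs.le⟩⟩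

theorem agreeOn_limitWeights_pos {w w' : Scenario n} (hw : w ∈ IIS n) (hw' : w' ∈ IIS n)
    (h : limitWeights w 0 = limitWeights w' 0) :
    AgreeOn w w' fun s => {p | 0 < limitWeights w s p} := fun s _ hp =>
  ⟨limitWeights_pos_of_le hw s.le_succ hp, fun j =>
    ⟨adj_iff_of_limitWeights_eq hw hw' h hp j, fun hj => limitWeights_pos_of_adj hw hp hj⟩⟩

/-- If the limit weights of all scenarios occur in `M`, then all finite executions occur in `M`. -/
theorem exists_mem_forall_lt_eq {M : Set (Scenario n)} (hM : M ⊆ IIS n)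
    (hfull : ∀ w ∈ IIS n, ∃ w' ∈ M, limitWeights w 0 = limitWeights w' 0)
    {w : Scenario n} (hw : w ∈ IIS n) (T : ℕ) : ∃ w' ∈ M, ∀ s < T, w' s = w s := by
  -- Continuing with complete graphs leads to an interior point of the simplex reached at time `T`.
  set v : Scenario n := fun s => if s < T then w s else ⊤ with hv
  have hvI : v ∈ IIS n := fun s => by
    by_cases hs : s < T
    · simpa only [hv, if_pos hs] using hw s
    · simpa only [hv, if_neg hs] using top_mem_IS
  obtain ⟨w', hw', heq⟩ := hfull v hvI
  refine ⟨w', hw', fun s hs => ?_⟩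
  have hvs : v s = w s := if_pos hs
  rw [← hvs]
  ext j i
  refine (adj_iff_of_limitWeights_eq hvI (hM hw') heq ?_ j).symm
  exact limitWeights_pos_of_le hvI (Nat.succ_le_of_lt hs)
    (limitWeights_pos_of_eq_top hvI (if_neg (lt_irrefl T)) i)

/-! ### Relaying decisions -/

open Classical in
/-- A decision value contained in one of the messages `m`, if there is any. -/
noncomputable def heardValue {μ : Type*} (m : Proc n → Option (μ × Option (Proc n))) :
    Option (Proc n) :=
  if h : ∃ v q a, m q = some (a, some v) then some h.choose else none

/-- The algorithm that runs `A`, attaches to every message a decision value that it knows of, and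
outputs such a value: its own decision, or else one that it has heard of. -/
noncomputable def Algorithm.relay (A : Algorithm n) : Algorithm n where
  State := A.State × Option (Proc n)
  Msg := Option A.Msg × Option (Proc n)
  start p v := (A.start p v, A.output p (A.start p v))
  send p s := some (A.send p s.1, s.2)
  update p s m :=
    (A.update p s.1 fun q => (m q).bind Prod.fst,
      (s.2.or (A.output p (A.update p s.1 fun q => (m q).bind Prod.fst))).or (heardValue m))
  output _ s := s.2

theorem Algorithm.relay_state_fst (A : Algorithm n) (ι : Proc n → Proc n) (w : Scenario n) (t : ℕ)
    (p : Proc n) : (A.relay.state ι w t p).1 = A.state ι w t p := by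
  classical
  induction t generalizing p with
  | zero => rfl
  | succ t ih =>
    simp only [Algorithm.state, Algorithm.relay] at ih ⊢
    rw [ih]
    congr 1
    funext q
    by_cases hq : (w t).Adj q p
    · simp only [if_pos hq, Option.bind_some, ih]
    · simp only [if_neg hq, Option.bind_none]

open Classical in
theorem Algorithm.relay_state_snd_succ (A : Algorithm n) (ι : Proc n → Proc n) (w : Scenario n)
    (t : ℕ) (p : Proc n) :
    (A.relay.state ι w (t + 1) p).2 =
      ((A.relay.state ι w t p).2.or (A.output p (A.state ι w (t + 1) p))).or
        (heardValue fun q => if (w t).Adj q p then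
          some (A.send q (A.relay.state ι w t q).1, (A.relay.state ι w t q).2) else none) := by
  rw [← A.relay_state_fst ι w (t + 1) p]
  rfl

theorem heardValue_isSome {μ : Type*} {m : Proc n → Option (μ × Option (Proc n))} {q : Proc n}
    {a : μ} {v : Proc n} (h : m q = some (a, some v)) : (heardValue m).isSome := by
  have : ∃ v q a, m q = some (a, some v) := ⟨v, q, a, h⟩
  simp [heardValue, this]

theorem exists_of_heardValue_eq_some {μ : Type*} {m : Proc n → Option (μ × Option (Proc n))}
    {v : Proc n} (h : heardValue m = some v) : ∃ q a, m q = some (a, some v) := by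
  unfold heardValue at h
  split_ifs at h with h'
  obtain rfl := Option.some.inj h
  exact h'.choose_spec

theorem Algorithm.relay_isSome_of_output (A : Algorithm n) {ι : Proc n → Proc n} {w : Scenario n}
    {t : ℕ} {p : Proc n} (h : (A.output p (A.state ι w t p)).isSome) :
    (A.relay.state ι w t p).2.isSome := by
  cases t with
  | zero => exact h
  | succ t =>
    rw [relay_state_snd_succ]
    simp [h]

theorem Algorithm.relay_isSome_succ_of_adj (A : Algorithm n) {ι : Proc n → Proc n}
    {w : Scenario n} {t : ℕ} {p q : Proc n} (hqp : (w t).Adj q p)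
    (h : (A.relay.state ι w t q).2.isSome) : (A.relay.state ι w (t + 1) p).2.isSome := by
  obtain ⟨v, hv⟩ := Option.isSome_iff_exists.1 h
  rw [relay_state_snd_succ, Option.isSome_or, Bool.or_eq_true]
  refine Or.inr (heardValue_isSome (q := q) (a := A.send q (A.relay.state ι w t q).1) (v := v) ?_)
  rw [if_pos hqp, hv]

theorem Algorithm.relay_isSome_mono (A : Algorithm n) {ι : Proc n → Proc n} {w : Scenario n}
    {s t : ℕ} (hst : s ≤ t) {p : Proc n} (h : (A.relay.state ι w s p).2.isSome) :
    (A.relay.state ι w t p).2.isSome := by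
  induction t, hst using Nat.le_induction with
  | base => exact h
  | succ t _ ih =>
    rw [relay_state_snd_succ]
    simp [ih]

/-- A process that gives a positive weight to the position of `q` at time `s` knows what `q` knew
at that time. -/
theorem Algorithm.relay_isSome_of_flow_pos (A : Algorithm n) {ι : Proc n → Proc n}
    {w : Scenario n} (hw : w ∈ IIS n) {s : ℕ} {q : Proc n}
    (h : (A.relay.state ι w s q).2.isSome) (r : ℕ) {p : Proc n} (hp : 0 < flow w s r p q) :
    (A.relay.state ι w (s + r) p).2.isSome := by
  classical
  induction r generalizing p with
  | zero =>
    have : p = q := by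
      by_contra hne
      simp [flow, hne] at hp
    rw [this]
    exact h
  | succ r ih =>
    rw [flow, Matrix.mul_apply] at hp
    obtain ⟨k, -, hk⟩ := Finset.exists_lt_of_sum_lt (s := Finset.univ) (f := fun _ => (0 : ℝ))
      (by simpa using hp)
    have hadj : (w (s + r)).Adj k p := by
      by_contra hn
      rw [stepMatrix_eq_zero (hw _) hn, zero_mul] at hk
      exact lt_irrefl _ hk
    exact A.relay_isSome_succ_of_adj hadj
      (ih (pos_of_mul_pos_right hk (stepMatrix_nonneg (hw _) _ _)))

/-- The value relayed by a process is the decision, already taken, of some process. -/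
theorem Algorithm.exists_decision_of_relay (A : Algorithm n) {ι : Proc n → Proc n}
    {w : Scenario n} {t : ℕ} {p v : Proc n} (h : (A.relay.state ι w t p).2 = some v) :
    ∃ q, ∃ u ≤ t, A.output q (A.state ι w u q) = some v ∧
      ∀ s < u, A.output q (A.state ι w s q) = none := by
  induction t generalizing p with
  | zero => exact ⟨p, 0, le_rfl, h, fun s hs => absurd hs s.not_lt_zero⟩
  | succ t ih =>
    rw [relay_state_snd_succ, Option.or_eq_some_iff, Option.or_eq_some_iff] at h
    rcases h with (h | ⟨hnone, h⟩) | ⟨-, h⟩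
    · obtain ⟨q, u, hu, hq⟩ := ih h
      exact ⟨q, u, hu.trans t.le_succ, hq⟩
    · refine ⟨p, t + 1, le_rfl, h, fun s hs => ?_⟩
      by_contra hne
      have := A.relay_isSome_mono (Nat.le_of_lt_succ hs)
        (A.relay_isSome_of_output (Option.isSome_iff_ne_none.2 hne))
      simp [hnone] at this
    · obtain ⟨q, a, hq⟩ := exists_of_heardValue_eq_some h
      split_ifs at hq with hadj
      rw [Option.some.injEq, Prod.mk.injEq] at hq
      obtain ⟨q', u, hu, hq'⟩ := ih hq.2
      exact ⟨q', u, hu.trans t.le_succ, hq'⟩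

/-- The value relayed by time `t` is decided in every scenario with the same first `t` rounds. -/
theorem Algorithm.exists_decides_of_relay (A : Algorithm n) {ι : Proc n → Proc n}
    {w w' : Scenario n} {t : ℕ} (hww' : ∀ s < t, w' s = w s) {p v : Proc n}
    (h : (A.relay.state ι w t p).2 = some v) : ∃ q, A.Decides ι w' q v := by
  obtain ⟨q, u, hu, hout, hnone⟩ := A.exists_decision_of_relay h
  have hstate : ∀ s ≤ t, A.state ι w' s q = A.state ι w s q := fun s hs =>
    A.state_eq_of_agreeOn (agreeOn_prefix hww') (fun _ _ => rfl) s hs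
  refine ⟨q, u, ?_, fun s hs => ?_⟩
  · rw [hstate u hu, hout]
  · rw [hstate s (hs.le.trans hu), hnone s hs]

/-! ### A uniform bound on the decision time -/

/-- If all processes decide in the scenarios of `M`, then in every scenario all processes come to
know a decision: a process whose weight stays positive cannot tell the scenario from one of `M`
with the same limit, so it decides, and the others eventually hear of it. -/
theorem Algorithm.exists_forall_relay_isSome (A : Algorithm n) {M : Set (Scenario n)}
    (hM : M ⊆ IIS n) (hfull : ∀ w ∈ IIS n, ∃ w' ∈ M, limitWeights w 0 = limitWeights w' 0)
    {ι : Proc n → Proc n} (hterm : ∀ w ∈ M, ∀ p, ∃ v, A.Decides ι w p v) {w : Scenario n}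
    (hw : w ∈ IIS n) : ∃ T, ∀ p, (A.relay.state ι w T p).2.isSome := by
  obtain ⟨w', hw', heq⟩ := hfull w hw
  obtain ⟨q, hq⟩ := exists_forall_limitWeights_pos hw
  obtain ⟨v, t, ht, -⟩ := hterm w' hw' q
  rw [← A.state_eq_of_agreeOn (agreeOn_limitWeights_pos hw (hM hw') heq) (fun _ _ => rfl) t
    (hq t)] at ht
  have hsome := A.relay_isSome_of_output (Option.isSome_iff_exists.2 ⟨v, ht⟩)
  have hev : ∀ᶠ r in atTop, ∀ p, 0 < flow w t r p q :=
    eventually_all.2 fun p => (tendsto_flow hw t p q).eventually (lt_mem_nhds (hq t))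
  obtain ⟨r, hr⟩ := hev.exists
  exact ⟨t + r, fun p => A.relay_isSome_of_flow_pos hw hsome r (hr p)⟩

/-- By compactness of the space of scenarios, a property that every scenario acquires, that
persists, and that depends at time `T` on the first `T` rounds only, is acquired uniformly. -/
theorem exists_uniform_time {P : Scenario n → ℕ → Prop}
    (hmono : ∀ w s t, s ≤ t → P w s → P w t)
    (hlocal : ∀ w w' T, (∀ s < T, w s = w' s) → P w T → P w' T)
    (hex : ∀ w ∈ IIS n, ∃ T, P w T) : ∃ T, ∀ w ∈ IIS n, P w T := by
  let _ : TopologicalSpace (Digraph (Proc n)) := ⊥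
  have : DiscreteTopology (Digraph (Proc n)) := ⟨rfl⟩
  have hcomp : IsCompact (IIS n) := by
    have : IIS n = Set.pi Set.univ fun _ => IS n := by
      ext w
      simp [IIS]
    rw [this]
    exact isCompact_univ_pi fun _ => (Set.toFinite (IS n)).isCompact
  have hopen : ∀ T, IsOpen {w | P w T} := fun T =>
    isOpen_iff_forall_mem_open.2 fun w hw => ⟨Set.pi (Set.Iio T) fun s => {w s},
      fun w' hw' => hlocal w w' T (fun s hs => (hw' s hs).symm) hw,
      isOpen_set_pi (Set.finite_Iio T) fun s _ => isOpen_discrete _, fun s _ => rfl⟩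
  obtain ⟨T, hT⟩ := hcomp.elim_directed_cover (fun T => {w | P w T}) hopen
    (fun w hw => Set.mem_iUnion.2 (hex w hw))
    (directed_of_isDirected_le fun s t hst w hw => hmono w s t hst hw)
  exact ⟨T, fun w hw => hT hw⟩

/-! ### Toggling a view -/

/-- The graph `G` with the view of `p` replaced by `X`. -/
def setView (G : Digraph (Proc n)) (p : Proc n) (X : Set (Proc n)) : Digraph (Proc n) where
  Adj j q := (q ≠ p ∧ G.Adj j q) ∨ (q = p ∧ j ∈ X)

theorem setView_adj_of_ne (G : Digraph (Proc n)) {p q : Proc n} (X : Set (Proc n)) (j : Proc n)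
    (h : q ≠ p) : (setView G p X).Adj j q ↔ G.Adj j q := by
  simp [setView, h]

theorem setView_adj_self (G : Digraph (Proc n)) (p : Proc n) (X : Set (Proc n)) (j : Proc n) :
    (setView G p X).Adj j p ↔ j ∈ X := by
  simp [setView]

theorem setView_setView (G : Digraph (Proc n)) (p : Proc n) (X Y : Set (Proc n)) :
    setView (setView G p X) p Y = setView G p Y := by
  ext j q
  by_cases h : q = p <;> simp [setView, h]

theorem setView_self (G : Digraph (Proc n)) (p : Proc n) :
    setView G p {j | G.Adj j p} = G := by
  ext j q
  by_cases h : q = p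
  · subst h
    simp [setView]
  · simp [setView, h]

/-- The least view that `p` can have, given the views of the other processes: `p` itself and the
processes that do not hear `p`. -/
def lowerView (G : Digraph (Proc n)) (p : Proc n) : Set (Proc n) :=
  {j | j = p ∨ ¬ G.Adj p j}

/-- The greatest view that `p` can have, given the views of the other processes: the processes
heard by all the others that hear `p`. -/
def upperView (G : Digraph (Proc n)) (p : Proc n) : Set (Proc n) :=
  {j | ∀ q, q ≠ p → G.Adj p q → G.Adj j q}

theorem lowerView_setView (G : Digraph (Proc n)) (p : Proc n) (X : Set (Proc n)) :
    lowerView (setView G p X) p = lowerView G p := by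
  ext j
  by_cases h : j = p
  · simp [lowerView, h]
  · simp [lowerView, h, setView_adj_of_ne]

theorem upperView_setView (G : Digraph (Proc n)) (p : Proc n) (X : Set (Proc n)) :
    upperView (setView G p X) p = upperView G p := by
  ext j
  refine forall_congr' fun q => forall_congr' fun hq => ?_
  rw [setView_adj_of_ne _ _ _ hq, setView_adj_of_ne _ _ _ hq]

theorem setView_lowerView_mem_IS {G : Digraph (Proc n)} (hG : G ∈ IS n) (p : Proc n) :
    setView G p (lowerView G p) ∈ IS n := by
  constructor
  · rintro a b c hab (⟨hc, hbc⟩ | ⟨rfl, hb⟩)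
    · refine Or.inl ⟨hc, ?_⟩
      rcases hab with ⟨-, hab⟩ | ⟨rfl, rfl | ha⟩
      · exact adj_trans hG hab hbc
      · exact hbc
      · exact adj_trans hG (adj_of_not_adj hG ha) hbc
    · refine Or.inr ⟨rfl, ?_⟩
      rcases hab with ⟨hbc, hab⟩ | ⟨-, ha⟩
      · exact Or.inr fun hca => (hb.resolve_left hbc) (adj_trans hG hca hab)
      · exact ha
  · intro a b
    by_cases ha : a = p
    · subst ha
      by_cases hb : b = a
      · exact Or.inl (Or.inr ⟨hb, Or.inl rfl⟩)
      · by_cases hab : G.Adj a b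
        · exact Or.inl (Or.inl ⟨hb, hab⟩)
        · exact Or.inr (Or.inr ⟨rfl, Or.inr hab⟩)
    · by_cases hb : b = p
      · subst hb
        by_cases hba : G.Adj b a
        · exact Or.inr (Or.inl ⟨ha, hba⟩)
        · exact Or.inl (Or.inr ⟨rfl, Or.inr hba⟩)
      · exact (hG.2 a b).imp (fun h => Or.inl ⟨hb, h⟩) fun h => Or.inl ⟨ha, h⟩

theorem setView_upperView_mem_IS {G : Digraph (Proc n)} (hG : G ∈ IS n) (p : Proc n) :
    setView G p (upperView G p) ∈ IS n := by
  constructor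
  · rintro a b c hab (⟨hc, hbc⟩ | ⟨rfl, hb⟩)
    · refine Or.inl ⟨hc, ?_⟩
      rcases hab with ⟨-, hab⟩ | ⟨rfl, ha⟩
      · exact adj_trans hG hab hbc
      · exact ha c hc hbc
    · refine Or.inr ⟨rfl, ?_⟩
      rcases hab with ⟨-, hab⟩ | ⟨-, ha⟩
      · exact fun q hq hcq => adj_trans hG hab (hb q hq hcq)
      · exact ha
  · intro a b
    by_cases ha : a = p
    · subst ha
      by_cases hb : b = a
      · exact Or.inl (Or.inr ⟨hb, fun q _ h => h⟩)
      · by_cases hab : G.Adj a b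
        · exact Or.inl (Or.inl ⟨hb, hab⟩)
        · exact Or.inr (Or.inr ⟨rfl, fun q _ h => adj_trans hG (adj_of_not_adj hG hab) h⟩)
    · by_cases hb : b = p
      · subst hb
        by_cases hba : G.Adj b a
        · exact Or.inr (Or.inl ⟨ha, hba⟩)
        · exact Or.inl (Or.inr ⟨rfl, fun q _ h => adj_trans hG (adj_of_not_adj hG hba) h⟩)
      · exact (hG.2 a b).imp (fun h => Or.inl ⟨hb, h⟩) fun h => Or.inl ⟨ha, h⟩

theorem view_eq_upperView {G : Digraph (Proc n)} (hG : G ∈ IS n) {p : Proc n}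
    (h : {j | G.Adj j p} ≠ lowerView G p) : {j | G.Adj j p} = upperView G p := by
  have hsub : lowerView G p ⊆ {j | G.Adj j p} := by
    rintro j (rfl | hj)
    · exact adj_refl hG j
    · exact adj_of_not_adj hG hj
  obtain ⟨j, hjp, hj⟩ := Set.exists_of_ssubset (hsub.ssubset_of_ne (Ne.symm h))
  simp only [lowerView, Set.mem_ofPred_eq, not_or, not_not] at hj
  exact Set.Subset.antisymm (fun i hi q _ hq => adj_trans hG hi hq)
    fun i hi => adj_trans hG (hi j hj.1 hj.2) hjp

theorem lowerView_ne_upperView {G : Digraph (Proc n)} (hG : G ∈ IS n) {p q : Proc n}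
    (hqp : q ≠ p) (hq : G.Adj p q) : lowerView G p ≠ upperView G p := by
  classical
  obtain ⟨k, hk, hmin⟩ := exists_source hG (Finset.univ.filter fun q => q ≠ p ∧ G.Adj p q)
    ⟨q, by simp [hqp, hq]⟩
  simp only [Finset.mem_filter, Finset.mem_univ, true_and] at hk hmin
  intro h
  have hup : k ∈ upperView G p := fun i hi hpi => hmin i ⟨hi, hpi⟩
  rw [← h] at hup
  exact hup.elim hk.1 fun h' => h' hk.2

open Classical in
/-- The graph obtained from `G` by exchanging the two possible views of `p`.  In terms of ordered
partitions: if the block of `p` is `{p}`, merge it with the next block, and otherwise split `p`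
off, in front of the other members of its block. -/
noncomputable def toggleView (G : Digraph (Proc n)) (p : Proc n) : Digraph (Proc n) :=
  setView G p (if {j | G.Adj j p} = lowerView G p then upperView G p else lowerView G p)

theorem toggleView_adj_of_ne (G : Digraph (Proc n)) {p q : Proc n} (j : Proc n) (h : q ≠ p) :
    (toggleView G p).Adj j q ↔ G.Adj j q :=
  setView_adj_of_ne _ _ _ h

theorem toggleView_mem_IS {G : Digraph (Proc n)} (hG : G ∈ IS n) (p : Proc n) :
    toggleView G p ∈ IS n := by
  unfold toggleView
  split_ifs
  · exact setView_upperView_mem_IS hG p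
  · exact setView_lowerView_mem_IS hG p

theorem toggleView_toggleView {G : Digraph (Proc n)} (hG : G ∈ IS n) {p q : Proc n}
    (hqp : q ≠ p) (hq : G.Adj p q) : toggleView (toggleView G p) p = G := by
  have hne := lowerView_ne_upperView hG hqp hq
  by_cases h : {j | G.Adj j p} = lowerView G p
  · have h1 : toggleView G p = setView G p (upperView G p) := by simp only [toggleView, if_pos h]
    have h2 : {j | (setView G p (upperView G p)).Adj j p} = upperView G p := by
      ext j
      exact setView_adj_self _ _ _ _
    rw [h1, toggleView, h2, lowerView_setView, if_neg hne.symm, setView_setView, ← h, setView_self]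
  · have h1 : toggleView G p = setView G p (lowerView G p) := by simp only [toggleView, if_neg h]
    have h2 : {j | (setView G p (lowerView G p)).Adj j p} = lowerView G p := by
      ext j
      exact setView_adj_self _ _ _ _
    rw [h1, toggleView, h2, lowerView_setView, if_pos rfl, setView_setView, upperView_setView,
      ← view_eq_upperView hG h, setView_self]

theorem toggleView_ne {G : Digraph (Proc n)} (hG : G ∈ IS n) {p q : Proc n}
    (hqp : q ≠ p) (hq : G.Adj p q) : toggleView G p ≠ G := by
  have hne := lowerView_ne_upperView hG hqp hq
  intro heq
  have h2 : ∀ X, {j | (setView G p X).Adj j p} = X := fun X => by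
    ext j
    exact setView_adj_self _ _ _ _
  have h3 : {j | (toggleView G p).Adj j p} = {j | G.Adj j p} := by rw [heq]
  rw [toggleView, h2] at h3
  split_ifs at h3 with h
  · exact hne (h.symm.trans h3.symm)
  · exact h h3.symm

/-! ### Toggling the last round in which a process is heard -/

/-- Some process `q < k` other than `p` hears `p`. -/
def HeardBelow (k : ℕ) (G : Digraph (Proc n)) (p : Proc n) : Prop :=
  ∃ q : Proc n, q.val < k ∧ q ≠ p ∧ G.Adj p q

/-- Among the first `T` rounds of `w`, round `r` is the last in which `p` is heard by another
process `q < k`. -/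
def LastHeard (T k : ℕ) (w : Scenario n) (p : Proc n) (r : ℕ) : Prop :=
  r < T ∧ HeardBelow k (w r) p ∧ ∀ s, r < s → s < T → ¬ HeardBelow k (w s) p

theorem LastHeard.unique {T k : ℕ} {w : Scenario n} {p : Proc n} {r r' : ℕ}
    (h : LastHeard T k w p r) (h' : LastHeard T k w p r') : r = r' := by
  rcases lt_trichotomy r r' with hlt | heq | hlt
  · exact absurd h'.2.1 (h.2.2 r' hlt h'.1)
  · exact heq
  · exact absurd h.2.1 (h'.2.2 r hlt h.1)

theorem exists_lastHeard {T k : ℕ} {w : Scenario n} {p : Proc n}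
    (h : ∃ r < T, HeardBelow k (w r) p) : ∃ r, LastHeard T k w p r := by
  classical
  obtain ⟨r₀, hr₀, h₀⟩ := h
  obtain ⟨r, hr, hmax⟩ := ((Finset.range T).filter fun r => HeardBelow k (w r) p).exists_max_image
    id ⟨r₀, by simp [hr₀, h₀]⟩
  simp only [Finset.mem_filter, Finset.mem_range, id] at hr hmax
  exact ⟨r, hr.1, hr.2, fun s hrs hs hsp => (hmax s ⟨hs, hsp⟩).not_gt hrs⟩

open Classical in
/-- The scenario in which the view of `p` is toggled in the last round, among the first `T`, in
which `p` is heard by another process `q < k`. -/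
noncomputable def toggle (T k : ℕ) (w : Scenario n) (p : Proc n) : Scenario n :=
  if h : ∃ r, LastHeard T k w p r then
    Function.update w h.choose (toggleView (w h.choose) p) else w

theorem toggle_eq {T k : ℕ} {w : Scenario n} {p : Proc n} {r : ℕ} (h : LastHeard T k w p r) :
    toggle T k w p = Function.update w r (toggleView (w r) p) := by
  have hex : ∃ r, LastHeard T k w p r := ⟨r, h⟩
  rw [toggle, dif_pos hex, hex.choose_spec.unique h]

theorem toggle_apply_self {T k : ℕ} {w : Scenario n} {p : Proc n} {r : ℕ}
    (h : LastHeard T k w p r) : toggle T k w p r = toggleView (w r) p := by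
  rw [toggle_eq h, Function.update_self]

theorem toggle_apply_of_ne {T k : ℕ} {w : Scenario n} {p : Proc n} {r s : ℕ}
    (h : LastHeard T k w p r) (hs : s ≠ r) : toggle T k w p s = w s := by
  rw [toggle_eq h, Function.update_of_ne hs]

theorem toggle_adj_of_ne {T k : ℕ} {w : Scenario n} {p q : Proc n} {r : ℕ}
    (h : LastHeard T k w p r) (s : ℕ) (j : Proc n) (hq : q ≠ p) :
    (toggle T k w p s).Adj j q ↔ (w s).Adj j q := by
  by_cases hs : s = r
  · rw [hs, toggle_apply_self h, toggleView_adj_of_ne _ _ hq]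
  · rw [toggle_apply_of_ne h hs]

theorem heardBelow_toggle {T k : ℕ} {w : Scenario n} {p : Proc n} {r : ℕ}
    (h : LastHeard T k w p r) (s : ℕ) : HeardBelow k (toggle T k w p s) p ↔ HeardBelow k (w s) p :=
  exists_congr fun _ => and_congr_right fun _ => and_congr_right fun hq =>
    toggle_adj_of_ne h s p hq

theorem lastHeard_toggle {T k : ℕ} {w : Scenario n} {p : Proc n} {r : ℕ}
    (h : LastHeard T k w p r) : LastHeard T k (toggle T k w p) p r :=
  ⟨h.1, (heardBelow_toggle h r).2 h.2.1, fun s hrs hs => mt (heardBelow_toggle h s).1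
    (h.2.2 s hrs hs)⟩

theorem toggle_mem_IIS {T k : ℕ} {w : Scenario n} (hw : w ∈ IIS n) {p : Proc n} {r : ℕ}
    (h : LastHeard T k w p r) : toggle T k w p ∈ IIS n := fun s => by
  by_cases hs : s = r
  · rw [hs, toggle_apply_self h]
    exact toggleView_mem_IS (hw r) p
  · rw [toggle_apply_of_ne h hs]
    exact hw s

theorem toggle_toggle {T k : ℕ} {w : Scenario n} (hw : w ∈ IIS n) {p : Proc n} {r : ℕ}
    (h : LastHeard T k w p r) : toggle T k (toggle T k w p) p = w := by
  funext s
  obtain ⟨q, -, hqp, hq⟩ := h.2.1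
  by_cases hs : s = r
  · rw [hs, toggle_apply_self (lastHeard_toggle h), toggle_apply_self h,
      toggleView_toggleView (hw r) hqp hq]
  · rw [toggle_apply_of_ne (lastHeard_toggle h) hs, toggle_apply_of_ne h hs]

theorem toggle_ne {T k : ℕ} {w : Scenario n} (hw : w ∈ IIS n) {p : Proc n} {r : ℕ}
    (h : LastHeard T k w p r) : toggle T k w p ≠ w := fun heq => by
  obtain ⟨q, -, hqp, hq⟩ := h.2.1
  refine toggleView_ne (hw r) hqp hq ?_
  rw [← toggle_apply_self h, heq]

/-- If the processes `q < k` hear only one another, then none of them but `p` can tell `w` from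
the toggled scenario within the first `T` rounds: after the toggled round they do not hear `p`. -/
theorem agreeOn_toggle {T k : ℕ} {w : Scenario n} {p : Proc n} {r : ℕ}
    (h : LastHeard T k w p r)
    (hclosed : ∀ s < T, ∀ q j : Proc n, q.val < k → (w s).Adj j q → j.val < k) :
    AgreeOn w (toggle T k w p) fun s => {q | s ≤ T ∧ (r < s → q.val < k ∧ q ≠ p)} := by
  rintro s q ⟨hs, hq⟩
  refine ⟨⟨(Nat.le_succ s).trans hs, fun hrs => hq (hrs.trans s.lt_succ_self)⟩, fun j => ?_⟩
  rcases lt_or_ge s r with hsr | hrs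
  · rw [toggle_apply_of_ne h hsr.ne]
    exact ⟨Iff.rfl, fun _ => ⟨(Nat.le_succ s).trans hs, fun hrs => absurd hrs hsr.not_gt⟩⟩
  · obtain ⟨hqk, hqp⟩ := hq (Nat.lt_succ_of_le hrs)
    refine ⟨(toggle_adj_of_ne h s j hqp).symm, fun hj => ⟨(Nat.le_succ s).trans hs, fun hrs' =>
      ⟨hclosed s hs q j hqk hj, ?_⟩⟩⟩
    rintro rfl
    exact h.2.2 s hrs' hs ⟨q, hqk, hqp, hj⟩

/-! ### Faces -/

/-- The scenarios that run as immediate snapshots during `T` rounds, in which the processes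
`j ≥ k` come one by one, in increasing order, after all the others, and which continue with the
complete graph.  They encode the simplices of the `T`-fold chromatic subdivision of the face with
vertices `0, …, k - 1`. -/
def faceScenarios (n T k : ℕ) : Set (Scenario n) :=
  {w | (∀ r < T, w r ∈ IS n ∧ ∀ j : Proc n, k ≤ j.val → ∀ i,
      ((w r).Adj i j ↔ i ≤ j) ∧ ((w r).Adj j i ↔ j ≤ i)) ∧ ∀ r, T ≤ r → w r = ⊤}

theorem finite_faceScenarios (n T k : ℕ) : (faceScenarios n T k).Finite := by
  refine Set.Finite.of_injOn (f := fun w (r : Fin T) => w r) (t := Set.univ)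
    (fun _ _ => Set.mem_univ _) (fun w hw w' hw' h => ?_) Set.finite_univ
  funext r
  by_cases hr : r < T
  · exact congrFun h ⟨r, hr⟩
  · rw [hw.2 r (not_lt.1 hr), hw'.2 r (not_lt.1 hr)]

theorem faceScenarios_subset_IIS (T k : ℕ) : faceScenarios n T k ⊆ IIS n := fun w hw r => by
  by_cases hr : r < T
  · exact (hw.1 r hr).1
  · rw [hw.2 r (not_lt.1 hr)]
    exact top_mem_IS

theorem faceScenarios_closed {T k : ℕ} {w : Scenario n} (hw : w ∈ faceScenarios n T k) :
    ∀ s < T, ∀ q j : Proc n, q.val < k → (w s).Adj j q → j.val < k := by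
  intro s hs q j hq hj
  by_contra hk
  have := (((hw.1 s hs).2 j (not_lt.1 hk) q).2).1 hj
  exact hk (lt_of_le_of_lt this hq)

theorem toggle_mem_faceScenarios {T k : ℕ} {w : Scenario n} (hw : w ∈ faceScenarios n T k)
    {p : Proc n} (hp : p.val < k) {r : ℕ} (h : LastHeard T k w p r) :
    toggle T k w p ∈ faceScenarios n T k := by
  refine ⟨fun s hs => ⟨toggle_mem_IIS (faceScenarios_subset_IIS T k hw) h s, fun j hj i => ?_⟩,
    fun s hs => ?_⟩
  · obtain ⟨h1, h2⟩ := (hw.1 s hs).2 j hj i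
    have hjp : j ≠ p := fun h => by
      rw [h] at hj
      exact hj.not_gt hp
    refine ⟨(toggle_adj_of_ne h s i hjp).trans h1, ?_⟩
    by_cases hip : i = p
    · subst hip
      by_cases hsr : s = r
      · -- The toggled view of `p` contains no process `j ≥ k`, as `p` is heard by some `q < k`.
        subst hsr
        have hij : i ≤ j := (hp.trans_le hj).le
        have hji : ¬ j ≤ i := fun h' => hj.not_gt (lt_of_le_of_lt h' hp)
        rw [toggle_apply_self h]
        refine iff_of_false ?_ hji
        obtain ⟨q, hqk, hqi, hq⟩ := h.2.1
        rw [toggleView, setView_adj_self]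
        split_ifs
        · intro hmem
          exact (faceScenarios_closed hw s hs q j hqk (hmem q hqi hq)).not_ge hj
        · rintro (h' | h')
          · exact hjp h'
          · exact h' (((hw.1 s hs).2 j hj i).1.2 hij)
      · rwa [toggle_apply_of_ne h hsr]
    · exact (toggle_adj_of_ne h s j hip).trans h2
  · rw [toggle_apply_of_ne h (h.1.trans_le hs).ne', hw.2 s hs]

/-! ### Sperner's lemma for iterated immediate snapshots -/

/-- The local count in Sperner's lemma: the facets of a simplex that carry exactly the colours of
`B` are one in number if the simplex carries all the colours of `insert b B`, and zero or two
otherwise. -/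
theorem card_doors_parity {α : Type*} [DecidableEq α] (f : α → α) {A B : Finset α} {b : α}
    (hb : b ∉ B) (hcard : A.card = B.card + 1) (hf : ∀ a ∈ A, f a ∈ insert b B) :
    ((A.filter fun p => (A.erase p).image f = B).card : ZMod 2) =
      if A.image f = insert b B then 1 else 0 := by
  have herase : ∀ p ∈ A, (A.erase p).card = B.card := fun p hp => by
    rw [Finset.card_erase_of_mem hp, hcard, Nat.add_sub_cancel]
  have himage : ∀ p ∈ A, A.image f = insert (f p) ((A.erase p).image f) := fun p hp => by
    rw [← Finset.image_insert, Finset.insert_erase hp]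
  split_ifs with hfull
  · have hinj : Set.InjOn f A := Finset.card_image_iff.1 (by
      rw [hfull, Finset.card_insert_of_notMem hb, hcard])
    obtain ⟨p, hp, hpb⟩ := Finset.mem_image.1 (hfull ▸ Finset.mem_insert_self b B)
    have : (A.filter fun p => (A.erase p).image f = B) = {p} := by
      ext q
      rw [Finset.mem_filter, Finset.mem_singleton]
      constructor
      · rintro ⟨hq, hqB⟩
        by_contra hne
        refine hb ?_
        rw [← hqB, ← hpb]
        exact Finset.mem_image_of_mem f (Finset.mem_erase.2 ⟨Ne.symm hne, hp⟩)
      · rintro rfl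
        refine ⟨hp, ?_⟩
        have hnot : f q ∉ (A.erase q).image f := fun h => by
          obtain ⟨d, hd, hdq⟩ := Finset.mem_image.1 h
          exact (Finset.mem_erase.1 hd).1 (hinj (Finset.mem_of_mem_erase hd) hp hdq)
        rw [← Finset.erase_insert hnot, ← himage q hp, hfull, hpb, Finset.erase_insert hb]
    rw [this]
    simp
  · by_cases hdoor : ∃ p ∈ A, (A.erase p).image f = B
    · obtain ⟨p, hp, hpB⟩ := hdoor
      have hfp : f p ∈ B := (Finset.mem_insert.1 (hf p hp)).resolve_left fun h =>
        hfull (by rw [himage p hp, hpB, h])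
      have hinj : Set.InjOn f (A.erase p) := Finset.card_image_iff.1 (by rw [hpB, herase p hp])
      obtain ⟨p', hp', hfp'⟩ := Finset.mem_image.1 (hpB ▸ hfp)
      obtain ⟨hne, hp'A⟩ := Finset.mem_erase.1 hp'
      have : (A.filter fun p => (A.erase p).image f = B) = {p, p'} := by
        ext q
        rw [Finset.mem_filter, Finset.mem_insert, Finset.mem_singleton]
        constructor
        · rintro ⟨hq, hqB⟩
          by_contra! hcon
          -- Both `p` and `p'` survive the erasure of `q` and have the same colour.
          have hinj' : Set.InjOn f (A.erase q) :=
            Finset.card_image_iff.1 (by rw [hqB, herase q hq])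
          exact hne (hinj' (Finset.mem_coe.2 (Finset.mem_erase.2 ⟨hcon.2.symm, hp'A⟩))
            (Finset.mem_coe.2 (Finset.mem_erase.2 ⟨hcon.1.symm, hp⟩)) hfp')
        · rintro (rfl | rfl)
          · exact ⟨hp, hpB⟩
          · refine ⟨hp'A, Finset.Subset.antisymm ?_ ?_⟩
            · intro c hc
              obtain ⟨d, hd, rfl⟩ := Finset.mem_image.1 hc
              have hmem := Finset.mem_image_of_mem f (Finset.mem_of_mem_erase hd)
              rwa [himage p hp, hpB, Finset.insert_eq_of_mem hfp] at hmem
            · intro c hc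
              rw [← hpB] at hc
              obtain ⟨d, hd, rfl⟩ := Finset.mem_image.1 hc
              obtain ⟨hdp, hdA⟩ := Finset.mem_erase.1 hd
              by_cases hdq : d = q
              · rw [hdq, hfp']
                exact Finset.mem_image_of_mem f (Finset.mem_erase.2 ⟨Ne.symm hne, hp⟩)
              · exact Finset.mem_image_of_mem f (Finset.mem_erase.2 ⟨hdq, hdA⟩)
      rw [this, Finset.card_pair (Ne.symm hne)]
      rfl
    · push Not at hdoor
      rw [Finset.filter_eq_empty_iff.2 fun p hp => hdoor p hp]
      simp

/-- The processes `0, …, k - 1`. -/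
def below (n k : ℕ) : Finset (Proc n) :=
  Finset.univ.filter fun i => i.val < k

theorem mem_below {k : ℕ} {i : Proc n} : i ∈ below n k ↔ i.val < k := by
  simp [below]

theorem below_succ (k : Proc n) : below n (k.val + 1) = insert k (below n k) := by
  ext i
  rw [Finset.mem_insert, mem_below, mem_below, Fin.ext_iff]
  omega

theorem notMem_below_self (k : Proc n) : k ∉ below n k := by
  simp [mem_below]

theorem card_below_succ (k : Proc n) : (below n (k.val + 1)).card = (below n k).card + 1 := by
  rw [below_succ, Finset.card_insert_of_notMem (notMem_below_self k)]

/-- `f` colours the vertices of the `T`-fold chromatic subdivision by processes, where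
`f w p` is the colour of the vertex of `p` in the simplex of `w`: the colour depends on
the view of `p` only, and it is one of the processes that `p` has heard of. -/
structure IsSpernerColoring (T : ℕ) (f : Scenario n → Proc n → Proc n) : Prop where
  congr : ∀ w ∈ IIS n, ∀ w' ∈ IIS n, ∀ Q, AgreeOn w w' Q → ∀ p ∈ Q T, f w p = f w' p
  mem : ∀ w ∈ IIS n, ∀ Q : Set (Proc n),
    (∀ s < T, ∀ q ∈ Q, ∀ j, (w s).Adj j q → j ∈ Q) → ∀ q ∈ Q, f w q ∈ Q

section

variable {T : ℕ} {f : Scenario n → Proc n → Proc n}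

theorem IsSpernerColoring.apply_mem_below (hf : IsSpernerColoring T f) {k : ℕ} {w : Scenario n}
    (hw : w ∈ faceScenarios n T k) : ∀ q ∈ below n k, f w q ∈ below n k :=
  hf.mem w (faceScenarios_subset_IIS T k hw) (below n k) fun s hs q hq j hj =>
    mem_below.2 (faceScenarios_closed hw s hs q j (mem_below.1 hq) hj)

/-- The facet opposite to `p`, of the simplex of `w` in the face `0, …, k`, has exactly the
colours `0, …, k - 1`. -/
def IsDoor (f : Scenario n → Proc n → Proc n) (k : ℕ) (w : Scenario n) (p : Proc n) : Prop :=
  ((below n (k + 1)).erase p).image (f w) = below n k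

/-- A door that lies on no other simplex of the face `0, …, k` lies on the face `0, …, k - 1`. -/
theorem IsSpernerColoring.boundary_door (hf : IsSpernerColoring T f) {k : Proc n}
    {w : Scenario n} {p : Proc n} (hw : w ∈ faceScenarios n T (k + 1))
    (hp : p ∈ below n (k.val + 1)) (hd : IsDoor f k w p)
    (hunheard : ∀ r < T, ¬ HeardBelow (k + 1) (w r) p) :
    p = k ∧ w ∈ faceScenarios n T k := by
  have hclosed := faceScenarios_closed hw
  have hpk : p = k := by
    have hmem := hf.mem w (faceScenarios_subset_IIS T _ hw) ((below n (k.val + 1)).erase p)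
      fun s hs q hq j hj => by
        rw [Finset.mem_coe, Finset.mem_erase, mem_below] at hq ⊢
        refine ⟨?_, hclosed s hs q j hq.2 hj⟩
        rintro rfl
        exact hunheard s hs ⟨q, hq.2, hq.1, hj⟩
    rw [below_succ, Finset.mem_insert] at hp
    refine hp.resolve_right fun hpk => ?_
    rw [← hd] at hpk
    obtain ⟨q, hq, hqp⟩ := Finset.mem_image.1 hpk
    have := hmem q (Finset.mem_coe.2 hq)
    rw [hqp] at this
    exact Finset.notMem_erase p _ this
  subst hpk
  refine ⟨rfl, fun r hr => ⟨(hw.1 r hr).1, fun j hj i => ?_⟩, hw.2⟩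
  rcases hj.eq_or_lt with hj | hj
  · obtain rfl : p = j := Fin.ext hj
    rcases lt_trichotomy i p with hi | rfl | hi
    · have hnot : ¬ (w r).Adj p i := fun h =>
        hunheard r hr ⟨i, (Fin.lt_def.1 hi).trans p.val.lt_succ_self, hi.ne, h⟩
      exact ⟨iff_of_true (adj_of_not_adj (hw.1 r hr).1 hnot) hi.le, iff_of_false hnot hi.not_ge⟩
    · exact ⟨iff_of_true (adj_refl (hw.1 r hr).1 i) le_rfl,
        iff_of_true (adj_refl (hw.1 r hr).1 i) le_rfl⟩
    · exact ((hw.1 r hr).2 i (Fin.lt_def.1 hi) p).symm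
  · exact (hw.1 r hr).2 j hj i

theorem mem_faceScenarios_succ {k : ℕ} {w : Scenario n} (hw : w ∈ faceScenarios n T k) :
    w ∈ faceScenarios n T (k + 1) :=
  ⟨fun r hr => ⟨(hw.1 r hr).1, fun j hj => (hw.1 r hr).2 j (k.le_succ.trans hj)⟩, hw.2⟩

theorem not_heardBelow_of_mem_faceScenarios {k : Proc n} {w : Scenario n}
    (hw : w ∈ faceScenarios n T k) {r : ℕ} (hr : r < T) : ¬ HeardBelow (k + 1) (w r) k := by
  rintro ⟨q, hq, hqk, h⟩
  have := Fin.le_def.1 ((((hw.1 r hr).2 k le_rfl q).2).1 h)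
  exact hqk (Fin.ext (le_antisymm (Nat.lt_succ_iff.1 hq) this))

theorem IsSpernerColoring.isDoor_toggle (hf : IsSpernerColoring T f) {k : ℕ} {w : Scenario n}
    (hw : w ∈ faceScenarios n T (k + 1)) {p : Proc n} {r : ℕ} (hr : LastHeard T (k + 1) w p r)
    (hd : IsDoor f k w p) : IsDoor f k (toggle T (k + 1) w p) p := by
  have hwI := faceScenarios_subset_IIS T _ hw
  rw [IsDoor] at hd ⊢
  rw [← hd]
  refine Finset.image_congr fun q hq => ?_
  rw [Finset.mem_coe, Finset.mem_erase, mem_below] at hq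
  exact (hf.congr w hwI _ (toggle_mem_IIS hwI hr) _ (agreeOn_toggle hr (faceScenarios_closed hw)) q
    ⟨le_rfl, fun _ => ⟨hq.2, hq.1⟩⟩).symm

open Classical in
/-- The number of simplices of the `T`-fold chromatic subdivision of the face `0, …, k - 1` that
carry all the colours of this face. -/
noncomputable def rainbowCount (T : ℕ) (f : Scenario n → Proc n → Proc n) (k : ℕ) : ℕ :=
  ((finite_faceScenarios n T k).toFinset.filter fun w =>
    (below n k).image (f w) = below n k).card

/-- Both numbers have the parity of the number of doors. -/
theorem IsSpernerColoring.rainbowCount_succ (hf : IsSpernerColoring T f) (k : Proc n) :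
    (rainbowCount T f (k.val + 1) : ZMod 2) = rainbowCount T f k := by
  classical
  set E := (finite_faceScenarios n T (k.val + 1)).toFinset with hE
  have memE : ∀ {w}, w ∈ E ↔ w ∈ faceScenarios n T (k.val + 1) := by
    simp [hE]
  set doors := (E ×ˢ below n (k.val + 1)).filter fun x => IsDoor f k x.1 x.2 with hdoors
  have memdoors : ∀ {x}, x ∈ doors ↔
      (x.1 ∈ faceScenarios n T (k.val + 1) ∧ x.2 ∈ below n (k.val + 1)) ∧ IsDoor f k x.1 x.2 := by
    simp [hdoors, memE]
  set H : Scenario n × Proc n → Prop := fun x => ∃ r < T, HeardBelow (k.val + 1) (x.1 r) x.2 with hH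
  have hleft : (doors.card : ZMod 2) = rainbowCount T f (k.val + 1) := by
    have h1 : (doors.card : ZMod 2) =
        ∑ w ∈ E, (((below n (k.val + 1)).filter fun p => IsDoor f k w p).card : ZMod 2) := by
      rw [← Nat.cast_sum, hdoors, Finset.card_filter, Finset.sum_product]
      simp only [Finset.card_filter]
    rw [h1, rainbowCount, Finset.card_filter, Nat.cast_sum]
    refine Finset.sum_congr rfl fun w hw => ?_
    have := card_doors_parity (f w) (notMem_below_self k) (card_below_succ k)
      (by rw [← below_succ]; exact hf.apply_mem_below (memE.1 hw))
    rw [← below_succ] at this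
    rw [Nat.cast_ite, Nat.cast_one, Nat.cast_zero]
    convert this
    exact Iff.rfl
  -- Toggling pairs the doors whose opposite process is heard.
  have hheard : ((doors.filter H).card : ZMod 2) = 0 := by
    rw [Finset.card_eq_sum_ones, Nat.cast_sum]
    have memH : ∀ {x}, x ∈ doors.filter H →
        x ∈ doors ∧ ∃ r, LastHeard T (k.val + 1) x.1 x.2 r := fun hx =>
      ⟨(Finset.mem_filter.1 hx).1, exists_lastHeard (Finset.mem_filter.1 hx).2⟩
    refine Finset.sum_involution (fun x _ => (toggle T (k.val + 1) x.1 x.2, x.2))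
      (fun _ _ => by rw [Nat.cast_one]; rfl) (fun x hx _ => ?_) (fun x hx => ?_) fun x hx => ?_
    · obtain ⟨hx, r, hr⟩ := memH hx
      exact fun h => toggle_ne (faceScenarios_subset_IIS T _ (memdoors.1 hx).1.1) hr
        (congrArg Prod.fst h)
    · obtain ⟨hx, r, hr⟩ := memH hx
      obtain ⟨⟨hw, hp⟩, hd⟩ := memdoors.1 hx
      exact Finset.mem_filter.2 ⟨memdoors.2 ⟨⟨toggle_mem_faceScenarios hw (mem_below.1 hp) hr, hp⟩,
        hf.isDoor_toggle hw hr hd⟩, r, hr.1, (heardBelow_toggle hr r).2 hr.2.1⟩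
    · obtain ⟨hx, r, hr⟩ := memH hx
      exact Prod.ext (toggle_toggle (faceScenarios_subset_IIS T _ (memdoors.1 hx).1.1) hr) rfl
  have hunheard : (doors.filter fun x => ¬ H x).card = rainbowCount T f k := by
    have herase : (below n (k.val + 1)).erase k = below n k := by
      rw [below_succ, Finset.erase_insert (notMem_below_self k)]
    have hback : ∀ x ∈ doors.filter fun x => ¬ H x, x.2 = k ∧ x.1 ∈ faceScenarios n T k := by
      intro x hx
      rw [Finset.mem_filter, memdoors] at hx
      exact hf.boundary_door hx.1.1.1 hx.1.1.2 hx.1.2 fun r hr h => hx.2 ⟨r, hr, h⟩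
    refine Finset.card_nbij' Prod.fst (fun w => (w, k)) (fun x hx => ?_) (fun w hw => ?_)
      (fun x hx => ?_) fun w _ => rfl
    · obtain ⟨hk, hw⟩ := hback x hx
      have hd := (memdoors.1 (Finset.mem_filter.1 hx).1).2
      rw [IsDoor, hk, herase] at hd
      simpa using ⟨hw, hd⟩
    · simp only [Finset.coe_filter, Set.mem_ofPred_eq, Set.Finite.mem_toFinset] at hw
      refine Finset.mem_coe.2 (Finset.mem_filter.2 ⟨memdoors.2 ⟨⟨mem_faceScenarios_succ hw.1,
        mem_below.2 k.val.lt_succ_self⟩, ?_⟩, ?_⟩)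
      · rw [IsDoor, herase]
        exact hw.2
      · rintro ⟨r, hr, h⟩
        exact not_heardBelow_of_mem_faceScenarios hw.1 hr h
    · exact Prod.ext rfl (hback x hx).1.symm
  rw [← hleft, ← Finset.card_filter_add_card_filter_not (s := doors) H, Nat.cast_add, hheard,
    zero_add, hunheard]

theorem rainbowCount_zero : rainbowCount T f 0 = 1 := by
  classical
  rw [rainbowCount, Finset.card_eq_one]
  refine ⟨fun r => if r < T then ⟨fun i j => i ≤ j⟩ else ⊤, ?_⟩
  ext w
  have h0 : below n 0 = ∅ := by simp [below]
  simp only [Finset.mem_filter, Set.Finite.mem_toFinset, h0, Finset.image_empty, and_true,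
    Finset.mem_singleton]
  constructor
  · intro hw
    funext r
    split_ifs with hr
    · ext i j
      exact ((hw.1 r hr).2 j (Nat.zero_le _) i).1
    · exact hw.2 r (not_lt.1 hr)
  · rintro rfl
    refine ⟨fun r hr => ?_, fun r hr => if_neg hr.not_gt⟩
    simp only [if_pos hr]
    exact ⟨⟨fun _ _ _ => le_trans, le_total⟩, fun j _ i => ⟨by simp, by simp⟩⟩

/-- A Sperner colouring of the `T`-fold chromatic subdivision has a simplex of all colours. -/
theorem IsSpernerColoring.exists_surjective (hf : IsSpernerColoring T f) :
    ∃ w ∈ IIS n, Function.Surjective (f w) := by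
  classical
  have hodd : ∀ k ≤ n + 1, (rainbowCount T f k : ZMod 2) = 1 := by
    intro k
    induction k with
    | zero => simp [rainbowCount_zero]
    | succ k ih =>
      intro hk
      rw [← ih (k.le_succ.trans hk)]
      exact hf.rainbowCount_succ ⟨k, hk⟩
  have hpos : rainbowCount T f (n + 1) ≠ 0 := fun h => by
    have := hodd (n + 1) le_rfl
    rw [h] at this
    simp at this
  obtain ⟨w, hw⟩ := Finset.card_ne_zero.1 hpos
  simp only [Finset.mem_filter, Set.Finite.mem_toFinset] at hw
  refine ⟨w, faceScenarios_subset_IIS T _ hw.1, fun v => ?_⟩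
  have hv : v ∈ below n (n + 1) := mem_below.2 v.isLt
  rw [← hw.2] at hv
  obtain ⟨p, -, hp⟩ := Finset.mem_image.1 hv
  exact ⟨p, hp⟩

end

/-! ### Impossibility of set-agreement -/

/-- Set-agreement is impossible as soon as every limit of scenarios is a limit of scenarios of `M`:
cut at a uniform time, the relay algorithm with distinct initial values gives a Sperner colouring
that uses at most `n` colours on each simplex. -/
theorem Algorithm.not_solvesSetAgreement (A : Algorithm n) {M : Set (Scenario n)} (hM : M ⊆ IIS n)
    (hfull : ∀ w ∈ IIS n, ∃ w' ∈ M, limitWeights w 0 = limitWeights w' 0) :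
    ¬ A.SolvesSetAgreement M := by
  classical
  intro hA
  obtain ⟨T, hT⟩ := exists_uniform_time
    (P := fun w T => ∀ p, (A.relay.state id w T p).2.isSome)
    (fun w s t hst h p => A.relay_isSome_mono hst (h p))
    (fun w w' T hww' h p => by
      rw [← A.relay.state_eq_of_agreeOn (agreeOn_prefix hww') (fun _ _ => rfl) T
        (Set.mem_ofPred_eq ▸ le_refl T)]
      exact h p)
    (fun w hw => A.exists_forall_relay_isSome hM hfull (hA.termination id) hw)
  have hsome : ∀ w ∈ IIS n, ∀ p, ∃ v, (A.relay.state id w T p).2 = some v := fun w hw p =>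
    Option.isSome_iff_exists.1 (hT w hw p)
  set f : Scenario n → Proc n → Proc n := fun w p => (A.relay.state id w T p).2.getD 0 with hf
  have hfw : ∀ w ∈ IIS n, ∀ p, (A.relay.state id w T p).2 = some (f w p) := fun w hw p => by
    obtain ⟨v, hv⟩ := hsome w hw p
    simp [hf, hv]
  have hcol : IsSpernerColoring T f := by
    refine ⟨fun w _ w' _ Q hQ p hp => ?_, fun w hw Q hQ q hq => ?_⟩
    · simp only [hf, A.relay.state_eq_of_agreeOn hQ (fun _ _ => rfl) T hp]
    · -- Give the initial value `q` to the processes outside `Q`, of which `q` has not heard.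
      set ι : Proc n → Proc n := fun p => if p ∈ Q then p else q with hι
      have hagree : AgreeOn w w fun s => {p | s ≤ T ∧ p ∈ Q} := fun s p hp =>
        ⟨⟨(Nat.le_succ s).trans hp.1, hp.2⟩, fun j => ⟨Iff.rfl, fun hj =>
          ⟨(Nat.le_succ s).trans hp.1, hQ s hp.1 p hp.2 j hj⟩⟩⟩
      have hstate := A.relay.state_eq_of_agreeOn hagree (ι := id) (ι' := ι)
        (fun p hp => by simp [hι, hp.2]) T ⟨le_rfl, hq⟩
      have hval := hfw w hw q
      rw [hstate] at hval
      obtain ⟨w', hw', hww'⟩ := exists_mem_forall_lt_eq hM hfull hw T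
      obtain ⟨p, hp⟩ := A.exists_decides_of_relay hww' hval
      obtain ⟨i, hi⟩ := hA.validity ι w' hw' p _ hp
      rw [hi, hι]
      dsimp only
      split_ifs with h
      · exact h
      · exact hq
  obtain ⟨w, hw, hsurj⟩ := hcol.exists_surjective
  obtain ⟨w', hw', hww'⟩ := exists_mem_forall_lt_eq hM hfull hw T
  have hall : {v | ∃ p, A.Decides id w' p v} = Set.univ := Set.eq_univ_of_forall fun v => by
    obtain ⟨p, rfl⟩ := hsurj v
    exact A.exists_decides_of_relay hww' (hfw w hw p)
  have := hA.agreement id w' hw'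
  rw [hall, Set.ncard_univ, Nat.card_eq_fintype_card, Fintype.card_fin] at this
  omega

end SubIIS

theorem mainTheorem3 {n N : ℕ} (S : Affine.Simplex ℝ (EuclideanSpace ℝ (Fin N)) n)
    (M : Set (SubIIS.Scenario n)) (hM : M ⊆ SubIIS.IIS n)
    (hgeo : SubIIS.geo S M = convexHull ℝ (Set.range S.points)) :
    ¬ ∃ A : SubIIS.Algorithm n, A.SolvesSetAgreement M := by
  rintro ⟨A, hA⟩
  exact A.not_solvesSetAgreement hM
    (fun _ hw => SubIIS.exists_mem_limitWeights_eq hM hgeo.ge hw) hA
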